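/- Let $\mathcal A$ be a unital algebra over $\mathbb C$ and let $\varphi,\varphi':\mathcal A\to\mathbb C$ be linear functionals with $\varphi(1_{\mathcal A})=1$ and $\varphi'(1_{\mathcal A})=0$ (so $(\mathcal A,\varphi,\varphi')$ is an infinitesimal noncommutative probability space). Unital subalgebras $\mathcal A_1,\dots,\mathcal A_k$ of $\mathcal A$ are called infinitesimally free if for all $n\ge 1$, all $i_1,\dots,i_n\in\{1,\dots,k\}$ with $i_1\ne i_2,\ i_2\neq i_3,\dots,\ i_{n-1}\ne i_n$, and all $a_1\in\mathcal A_{i_1},\dots,a_n\in\mathcal A_{i_n}$ with $\varphi(a_1)=\dots=\varphi(a_n)=0$, one has $\varphi(a_1\cdots a_n)=0$ and $$\varphi'(a_1\cdots a_n)=\begin{cases}\Bigl(\prod_{j=1}^{(n-1)/2}\varphi(a_j\,a_{n+1-j})\Bigr)\,\varphi'(a_{(n+1)/2}) & \text{if } n \text{ is odd and } i_j=i_{n+1-j} \text{ for } 1\le j\le (n-1)/2,\\ 0&\text{otherwise.}\end{cases}$$ Subsets $\mathcal X_1,\dots,\mathcal X_k$ of $\mathcal A$ are called infinitesimally free if the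 unital subalgebras they generate are infinitesimally free. Let $NC(n)$ be the lattice of non-crossing partitions of $\{1,\dots,n\}$, ordered by reverse refinement ($\pi\le\rho$ when every block of $\rho$ is a union of blocks of $\pi$), with largest element $1_n$ and Möbius function $\mathrm{M\ddot ob}$. For $V=\{v_1<\dots<v_m\}\subseteq\{1,\dots,n\}$ put $\varphi_V(a_1,\dots,a_n)=\varphi(a_{v_1}\cdots a_{v_m})$, and define $\varphi'_V$ in the same way from $\varphi'$. The non-crossing cumulants and the infinitesimal non-crossing cumulants are $$\kappa_n(a_1,\dots,a_n)=\sum_{\pi\in NC(n)}\mathrm{M\ddot ob}(\pi,1_n)\prod_{V\in\pi}\varphi_V(a_1,\dots,a_n),$$ $$\kappa_n'(a_1,\dots,a_n)=\sum_{\pi\in NC(n)}\sum_{V\in\pi}\mathrm{M\ddot ob}(\pi,1_n)\,\varphi'_V(a_1,\dots,a_n)\prod_{W\in\pi,\,W\ne V}\varphi_W(a_1,\dots,a_n).$$ Theorem. (a) Unital subalgebras $\mathcal A_1,\dots,\mathcal A_k$ of $\mathcal A$ are infinitesimally free if and only if for every $n\ge2$, all $i_1,\dots,i_n\in\{1,\dots,k\}$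 that are not all equal to each other, and all $a_1\in\mathcal A_{i_1},\dots,a_n\in\mathcal A_{i_n}$, one has $\kappa_n(a_1,\dots,a_n)=\kappa_n'(a_1,\dots,a_n)=0$. (b) Subsets $\mathcal X_1,\dots,\mathcal X_k$ of $\mathcal A$ are infinitesimally free if and only if for every $n\ge2$, all $i_1,\dots,i_n\in\{1,\dots,k\}$ that are not all equal to each other, and all $x_1\in\mathcal X_{i_1},\dots,x_n\in\mathcal X_{i_n}$, one has $\kappa_n(x_1,\dots,x_n)=\kappa_n'(x_1,\dots,x_n)=0$. -/

import Mathlib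

/-- A partition of `{1, …, n}` (here indexed by `Fin n`) is non-crossing when there are no
`p < q < r < s` with `p, r` in one block and `q, s` in another block. -/
def IsNonCrossing {n : ℕ} (π : Finpartition (Finset.univ : Finset (Fin n))) : Prop :=
  ∀ V ∈ π.parts, ∀ W ∈ π.parts, V ≠ W →
    ∀ p q r s : Fin n, p < q → q < r → r < s → p ∈ V → r ∈ V → q ∈ W → s ∈ W → False

/-- `NC(n)`: the non-crossing partitions of `{1, …, n}`. -/
def NC (n : ℕ) : Type :=
  {π : Finpartition (Finset.univ : Finset (Fin n)) // IsNonCrossing π}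

namespace NC

/-- The finite set of blocks of `π`. -/
def blocks {n : ℕ} (π : NC n) : Finset (Finset (Fin n)) := π.1.parts

/-- Reverse refinement: `π ≤ ρ` when every block of `π` is contained in a block of `ρ`. -/
instance instPartialOrder (n : ℕ) : PartialOrder (NC n) :=
  inferInstanceAs
    (PartialOrder {π : Finpartition (Finset.univ : Finset (Fin n)) // IsNonCrossing π})

noncomputable instance instDecidableEq (n : ℕ) : DecidableEq (NC n) := Classical.decEq _

noncomputable instance instFintype (n : ℕ) : Fintype (NC n) := by
  classical
  exact inferInstanceAs
    (Fintype {π : Finpartition (Finset.univ : Finset (Fin n)) // IsNonCrossing π})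

noncomputable instance instLocallyFiniteOrder (n : ℕ) : LocallyFiniteOrder (NC n) := by
  classical
  exact Fintype.toLocallyFiniteOrder

/-- The largest element `1_n` of `NC(n)`: for `n ≥ 1`, the partition with one block. -/
def one (n : ℕ) : NC n :=
  ⟨⊤, fun _ hV _ hW hne _ _ _ _ _ _ _ _ _ _ _ =>
    hne (Finpartition.parts_top_subsingleton _ hV hW)⟩

/-- The Möbius function of the poset `NC(n)`, with values in `ℂ`. -/
noncomputable def moebius {n : ℕ} (π ρ : NC n) : ℂ := IncidenceAlgebra.mu ℂ π ρ

end NC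

/-- An infinitesimal noncommutative probability space structure on the unital algebra `A`. -/
structure Incps (A : Type*) [Ring A] [Algebra ℂ A] where
  /-- the functional `φ` -/
  phi : A →ₗ[ℂ] ℂ
  /-- the functional `φ'` -/
  phi' : A →ₗ[ℂ] ℂ
  phi_one : phi 1 = 1
  phi'_one : phi' 1 = 0

/-- The restriction `(a_1, …, a_n) | V` of a tuple to the set `V` of positions, the positions
being taken in increasing order. -/
def restrictTuple {A : Type*} {n : ℕ} (a : Fin n → A) (V : Finset (Fin n)) : Fin V.card → A :=
  fun j => a (V.orderEmbOfFin rfl j)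

/-- The moment functional `f_n (a_1, …, a_n) = f (a_1 ⋯ a_n)` of a linear functional `f`. -/
def momentFunctional {A : Type*} [Ring A] [Algebra ℂ A] (f : A →ₗ[ℂ] ℂ) {n : ℕ}
    (a : Fin n → A) : ℂ :=
  f (List.ofFn a).prod

namespace Incps

variable {A : Type*} [Ring A] [Algebra ℂ A]

/-- The non-crossing cumulant functional `κ_n`. -/
noncomputable def kappa (P : Incps A) {n : ℕ} (a : Fin n → A) : ℂ :=
  ∑ π : NC n, NC.moebius π (NC.one n) *
    ∏ V ∈ π.blocks, momentFunctional P.phi (restrictTuple a V)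

/-- The infinitesimal non-crossing cumulant functional `κ_n'`. -/
noncomputable def kappa' (P : Incps A) {n : ℕ} (a : Fin n → A) : ℂ :=
  ∑ π : NC n, ∑ V ∈ π.blocks, NC.moebius π (NC.one n) *
    momentFunctional P.phi' (restrictTuple a V) *
      ∏ W ∈ π.blocks.erase V, momentFunctional P.phi (restrictTuple a W)

/-- Infinitesimal freeness of unital subalgebras `B_1, …, B_k`. Positions are counted from `0`,
so position `j` is opposite to `j.rev`, and the middle position for odd `n` is `n / 2`. -/
def InfinitesimallyFree (P : Incps A) {k : ℕ} (B : Fin k → Subalgebra ℂ A) : Prop :=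
  ∀ (n : ℕ) (hn : 1 ≤ n) (i : Fin n → Fin k) (a : Fin n → A),
    (∀ p q : Fin n, (q : ℕ) = p + 1 → i p ≠ i q) →
    (∀ j, a j ∈ B (i j)) →
    (∀ j, P.phi (a j) = 0) →
      P.phi (List.ofFn a).prod = 0 ∧
      P.phi' (List.ofFn a).prod =
        if Odd n ∧ ∀ j : Fin n, (j : ℕ) < n / 2 → i j = i j.rev then
          (∏ j ∈ Finset.univ.filter (fun j : Fin n => (j : ℕ) < n / 2), P.phi (a j * a j.rev)) *
            P.phi' (a ⟨n / 2, Nat.div_lt_self hn one_lt_two⟩)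
        else 0

/-- Vanishing of the mixed cumulants `κ_n` and `κ_n'`, `n ≥ 2`, with entries from the sets
`X_1, …, X_k`. -/
def MixedCumulantsVanish (P : Incps A) {k : ℕ} (X : Fin k → Set A) : Prop :=
  ∀ (n : ℕ), 2 ≤ n → ∀ (i : Fin n → Fin k), (¬ ∀ p q : Fin n, i p = i q) →
    ∀ a : Fin n → A, (∀ j, a j ∈ X (i j)) → P.kappa a = 0 ∧ P.kappa' a = 0

end Incps

/-! Over the dual numbers `ℂ[ε]`, `ε² = 0`, the functional `φ + εφ'` (`Incps.total`) has
non-crossing cumulants `κ_n + εκ_n'`: the `ε`-part of a product obeys the Leibniz rule, which yields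
the sum over a distinguished block. Vanishing of both cumulants is thus one condition over `ℂ[ε]`.

Any prescribed cumulants `c` are realised by a Fock-type model. A letter acts on a stack of open
letters by joining it, or by closing a block with an initial part of the stack, weighted by `c`. The
vacuum moments are then sums over non-crossing partitions (`Fock.state_prod_sort`), and Möbius
inversion recovers `c` (`Fock.sum_moebius_state`).

If `c` vanishes on words of mixed colours, a centred element of colour `i` sends stacks whose top
does not have colour `i` to stacks whose top does (`Fock.centred_mem_supported`), so alternating
centred products have no vacuum component. Here centring is over `ℂ[ε]`. If only `φ(a_j) = 0`, the
correction `εφ'(a_j)` is of first order, and `φ'(a_1⋯a_n)` becomes the sum over `j` of `φ'(a_j)`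
times `φ` of the word without `a_j`. Freeness for `φ` collapses that word from the gap outwards, so
that only the middle `j` can survive (`Incps.infinitesimallyFree_of_prod_eq`).

Hence vanishing mixed cumulants give freeness, the given functionals being the pushforward of such a
model. Conversely, infinitesimal freeness determines all mixed moments
(`Incps.InfinitesimallyFree.total_eq`); comparison with the model whose mixed cumulants are zero by
construction shows that the mixed cumulants vanish. -/

/-! ### Partial non-crossing partitions with open points -/

/-- `IsNCPart T S π`: the blocks of `π` form a non-crossing partition of `T \ S`, and no element
of `S ⊆ T` lies strictly between two elements of the same block. -/
structure IsNCPart {ι : Type*} [LinearOrder ι] (T S : Finset ι) (π : Finset (Finset ι)) : Prop where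
  subset_base : S ⊆ T
  nonempty : ∀ V ∈ π, V.Nonempty
  mem_base : ∀ V ∈ π, ∀ x ∈ V, x ∈ T
  notMem_open : ∀ V ∈ π, ∀ x ∈ V, x ∉ S
  cover : ∀ x ∈ T, x ∉ S → ∃ V ∈ π, x ∈ V
  eq_of_mem : ∀ V ∈ π, ∀ W ∈ π, ∀ x, x ∈ V → x ∈ W → V = W
  noncrossing : ∀ V ∈ π, ∀ W ∈ π, V ≠ W → ∀ p q r s : ι, p < q → q < r → r < s →
    p ∈ V → r ∈ V → q ∈ W → s ∈ W → False
  outer : ∀ V ∈ π, ∀ p ∈ V, ∀ r ∈ V, ∀ s ∈ S, p < s → s < r → False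

namespace IsNCPart

variable {ι : Type*} [LinearOrder ι] {T S : Finset ι} {π : Finset (Finset ι)} {a : ι}

theorem push (h : IsNCPart T S π) (ha : ∀ x ∈ T, a < x) :
    IsNCPart (insert a T) (insert a S) π := by
  obtain ⟨h1, h2, h3, h4, h5, h6, h7, h8⟩ := h
  refine ⟨Finset.insert_subset_insert a h1, h2, ?_, ?_, ?_, h6, h7, ?_⟩
  · intro V hV x hx; exact Finset.mem_insert_of_mem (h3 V hV x hx)
  · intro V hV x hx hxS
    rcases Finset.mem_insert.1 hxS with rfl | hxS
    · exact lt_irrefl _ (ha _ (h3 V hV x hx))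
    · exact h4 V hV x hx hxS
  · intro x hx hxS
    grind
  · intro V hV p hp r hr s hs hps hsr
    rcases Finset.mem_insert.1 hs with rfl | hs
    · exact lt_asymm hps (ha p (h3 V hV p hp))
    · exact h8 V hV p hp r hr s hs hps hsr

theorem unpush (h : IsNCPart (insert a T) S π) (ha : ∀ x ∈ T, a < x) (haS : a ∈ S) :
    IsNCPart T (S.erase a) π := by
  obtain ⟨h1, h2, h3, h4, h5, h6, h7, h8⟩ := h
  refine ⟨?_, h2, ?_, ?_, ?_, h6, h7, ?_⟩
  · intro x hx; have := h1 (Finset.mem_of_mem_erase hx); grind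
  · intro V hV x hx
    have := h3 V hV x hx
    have := h4 V hV x hx
    grind
  · intro V hV x hx hxS
    exact h4 V hV x hx (Finset.mem_of_mem_erase hxS)
  · intro x hx hxS
    exact h5 x (Finset.mem_insert_of_mem hx) (by have := ha x hx; grind)
  · intro V hV p hp r hr s hs hps hsr
    exact h8 V hV p hp r hr s (Finset.mem_of_mem_erase hs) hps hsr

/-- Only an initial segment `V₀` of the open points may join `a`: otherwise an open point left over
would be covered by the new block. -/
theorem close (h : IsNCPart T S π) (ha : ∀ x ∈ T, a < x) {V₀ : Finset ι} (hV₀ : V₀ ⊆ S)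
    (hlt : ∀ v ∈ V₀, ∀ s ∈ S \ V₀, v < s) :
    IsNCPart (insert a T) (S \ V₀) (insert (insert a V₀) π) := by
  obtain ⟨h1, h2, h3, h4, h5, h6, h7, h8⟩ := h
  have key : ∀ V ∈ π, ∀ x ∈ V, x ∉ insert a V₀ := by
    intro V hV x hx hx'
    rcases Finset.mem_insert.1 hx' with rfl | hx'
    · exact lt_irrefl _ (ha _ (h3 V hV x hx))
    · exact h4 V hV x hx (hV₀ hx')
  refine ⟨?_, ?_, ?_, ?_, ?_, ?_, ?_, ?_⟩
  · intro x hx; exact Finset.mem_insert_of_mem (h1 (Finset.mem_sdiff.1 hx).1)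
  · intro V hV
    rcases Finset.mem_insert.1 hV with rfl | hV
    · exact Finset.insert_nonempty _ _
    · exact h2 V hV
  · intro V hV x hx
    rcases Finset.mem_insert.1 hV with rfl | hV
    · exact Finset.insert_subset_insert a (hV₀.trans h1) hx
    · exact Finset.mem_insert_of_mem (h3 V hV x hx)
  · intro V hV x hx hxS
    have hxS' := Finset.mem_sdiff.1 hxS
    rcases Finset.mem_insert.1 hV with rfl | hV
    · rcases Finset.mem_insert.1 hx with rfl | hx
      · exact lt_irrefl _ (ha _ (h1 hxS'.1))
      · exact hxS'.2 hx
    · exact h4 V hV x hx hxS'.1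
  · intro x hx hxS
    by_cases hx' : x ∈ insert a V₀
    · exact ⟨_, Finset.mem_insert_self _ _, hx'⟩
    · have hxT : x ∈ T := by grind
      obtain ⟨V, hV, hxV⟩ := h5 x hxT (by grind)
      exact ⟨V, Finset.mem_insert_of_mem hV, hxV⟩
  · intro V hV W hW x hxV hxW
    rcases Finset.mem_insert.1 hV with rfl | hV <;> rcases Finset.mem_insert.1 hW with rfl | hW
    · rfl
    · exact (key W hW x hxW hxV).elim
    · exact (key V hV x hxV hxW).elim
    · exact h6 V hV W hW x hxV hxW
  · intro V hV W hW hne p q r s hpq hqr hrs hp hr hq hs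
    rcases Finset.mem_insert.1 hV with rfl | hV <;> rcases Finset.mem_insert.1 hW with rfl | hW
    · exact hne rfl
    -- The point `r` lies under the old block `W`. It is not `a`, which is least, so it was open,
    -- contrary to `outer`.
    · have hr' : r ∈ S := by
        rcases Finset.mem_insert.1 hr with hra | hr
        · exact absurd (ha q (h3 W hW q hq)) (not_lt.2 (hra ▸ hqr.le))
        · exact hV₀ hr
      exact h8 W hW q hq s hs r hr' hqr hrs
    · have hq' : q ∈ S := by
        rcases Finset.mem_insert.1 hq with hqa | hq
        · exact absurd (ha p (h3 V hV p hp)) (not_lt.2 (hqa ▸ hpq.le))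
        · exact hV₀ hq
      exact h8 V hV p hp r hr q hq' hpq hqr
    · exact h7 V hV W hW hne p q r s hpq hqr hrs hp hr hq hs
  · intro V hV p hp r hr s hs hps hsr
    rcases Finset.mem_insert.1 hV with rfl | hV
    · rcases Finset.mem_insert.1 hr with rfl | hr
      · exact lt_asymm hsr (ha s (h1 (Finset.mem_sdiff.1 hs).1))
      · exact lt_asymm hsr (hlt r hr s hs)
    · exact h8 V hV p hp r hr s (Finset.mem_sdiff.1 hs).1 hps hsr

/-- Inverse to `close`. The points released by `V` are covered by no other block, since such a block
would cross `V`, which also contains the least point `a`. -/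
theorem open_block (h : IsNCPart (insert a T) S π) (ha : ∀ x ∈ T, a < x) {V : Finset ι}
    (hV : V ∈ π) (haV : a ∈ V) :
    IsNCPart T (S ∪ V.erase a) (π.erase V) := by
  obtain ⟨h1, h2, h3, h4, h5, h6, h7, h8⟩ := h
  have haS : a ∉ S := h4 V hV a haV
  refine ⟨?_, ?_, ?_, ?_, ?_, ?_, ?_, ?_⟩
  · intro x hx
    have h3' := h3 V hV x
    have h1' := @h1 x
    grind
  · intro W hW; exact h2 W (Finset.mem_of_mem_erase hW)
  · intro W hW x hx
    have hW' := Finset.mem_erase.1 hW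
    rcases Finset.mem_insert.1 (h3 W hW'.2 x hx) with rfl | hxT
    · exact (hW'.1 (h6 W hW'.2 V hV _ hx haV)).elim
    · exact hxT
  · intro W hW x hx hxS
    have hW' := Finset.mem_erase.1 hW
    rcases Finset.mem_union.1 hxS with hxS | hxV
    · exact h4 W hW'.2 x hx hxS
    · exact hW'.1 (h6 W hW'.2 V hV _ hx (Finset.mem_of_mem_erase hxV))
  · intro x hxT hxS
    obtain ⟨W, hW, hxW⟩ := h5 x (Finset.mem_insert_of_mem hxT) (by grind)
    refine ⟨W, Finset.mem_erase.2 ⟨?_, hW⟩, hxW⟩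
    rintro rfl
    have := ha x hxT
    grind
  · intro W hW W' hW' x hx hx'
    exact h6 W (Finset.mem_of_mem_erase hW) W' (Finset.mem_of_mem_erase hW') x hx hx'
  · intro W hW W' hW' hne
    exact h7 W (Finset.mem_of_mem_erase hW) W' (Finset.mem_of_mem_erase hW') hne
  · intro W hW p hp r hr s hs hps hsr
    have hW' := Finset.mem_erase.1 hW
    rcases Finset.mem_union.1 hs with hs | hs
    · exact h8 W hW'.2 p hp r hr s hs hps hsr
    · have hap : a < p := by
        rcases Finset.mem_insert.1 (h3 W hW'.2 p hp) with rfl | hpT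
        · exact (hW'.1 (h6 W hW'.2 V hV _ hp haV)).elim
        · exact ha p hpT
      exact h7 V hV W hW'.2 hW'.1.symm a p s r hap hps hsr haV (Finset.mem_of_mem_erase hs) hp hr

/-- An open point below some `v ∈ V` would lie between `a` and `v`. So the points released by
`open_block` form an initial segment of the open ones, as `close` requires. -/
theorem lt_of_mem_block (h : IsNCPart (insert a T) S π) (ha : ∀ x ∈ T, a < x) {V : Finset ι}
    (hV : V ∈ π) (haV : a ∈ V) : ∀ v ∈ V, ∀ s ∈ S, v < s := by
  intro v hv s hs
  by_contra hlt
  have haS : a ∉ S := h.notMem_open V hV a haV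
  have hvS : v ∉ S := h.notMem_open V hV v hv
  have has : a < s := by
    rcases Finset.mem_insert.1 (h.subset_base hs) with rfl | hsT
    · exact (haS hs).elim
    · exact ha s hsT
  have hsv : s < v := lt_of_le_of_ne (not_lt.1 hlt) (by rintro rfl; exact hvS hs)
  exact h.outer V hV a haV v hv s hs has hsv

theorem eq_empty_of_empty (h : IsNCPart ∅ S π) : S = ∅ ∧ π = ∅ := by
  refine ⟨Finset.subset_empty.1 h.subset_base, Finset.eq_empty_of_forall_notMem fun V hV => ?_⟩
  obtain ⟨x, hx⟩ := h.nonempty V hV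
  exact absurd (h.mem_base V hV x hx) (Finset.notMem_empty x)

theorem empty : IsNCPart (∅ : Finset ι) ∅ ∅ := by
  constructor <;> simp

end IsNCPart

/-! ### Non-crossing partitions of finite sets and Möbius inversion -/

open Classical in
/-- The non-crossing partitions of the finite set `T`, as sets of blocks. -/
noncomputable def ncParts {ι : Type*} [LinearOrder ι] [Fintype ι] (T : Finset ι) :
    Finset (Finset (Finset ι)) :=
  Finset.univ.filter fun π => IsNCPart T ∅ π

theorem mem_ncParts {ι : Type*} [LinearOrder ι] [Fintype ι] {T : Finset ι}
    {π : Finset (Finset ι)} : π ∈ ncParts T ↔ IsNCPart T ∅ π := by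
  simp [ncParts]

namespace NC

variable {n : ℕ}

theorem isNCPart_blocks (π : NC n) : IsNCPart Finset.univ ∅ π.blocks where
  subset_base := Finset.empty_subset _
  nonempty V hV := π.1.nonempty_of_mem_parts hV
  mem_base _ _ _ _ := Finset.mem_univ _
  notMem_open _ _ _ _ := Finset.notMem_empty _
  cover x _ _ := π.1.exists_mem (Finset.mem_univ x)
  eq_of_mem V hV W hW x hxV hxW := π.1.eq_of_mem_parts hV hW hxV hxW
  noncrossing V hV W hW hne := π.2 V hV W hW hne
  outer := by simp

/-- The non-crossing partition with a given set of blocks. -/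
def ofBlocks (B : Finset (Finset (Fin n))) (h : IsNCPart Finset.univ ∅ B) : NC n :=
  ⟨Finpartition.ofExistsUnique B (fun _ _ => Finset.subset_univ _)
    (fun x hx => by
      obtain ⟨V, hV, hxV⟩ := h.cover x hx (Finset.notMem_empty x)
      exact ⟨V, ⟨hV, hxV⟩, fun W hW => h.eq_of_mem W hW.1 V hV x hW.2 hxV⟩)
    (fun h0 => by simpa using h.nonempty ∅ h0), h.noncrossing⟩

theorem blocks_ofBlocks (B : Finset (Finset (Fin n))) (h : IsNCPart Finset.univ ∅ B) :
    (ofBlocks B h).blocks = B := rfl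

theorem blocks_injective : Function.Injective (blocks : NC n → Finset (Finset (Fin n))) :=
  fun _ _ h => Subtype.ext (Finpartition.ext h)

theorem le_iff {π ρ : NC n} : π ≤ ρ ↔ ∀ V ∈ π.blocks, ∃ W ∈ ρ.blocks, V ⊆ W := Iff.rfl

theorem le_one (π : NC n) : π ≤ one n := (le_top : π.1 ≤ ⊤)

theorem blocks_one (hn : 1 ≤ n) : (one n).blocks = {Finset.univ} := by
  have : NeZero n := ⟨by omega⟩
  have h : (one n).blocks ⊆ {Finset.univ} := Finpartition.parts_top_subset _
  refine h.antisymm (Finset.singleton_subset_iff.2 ?_)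
  obtain ⟨V, hV, -⟩ := (one n).1.exists_mem (Finset.mem_univ (0 : Fin n))
  exact Finset.mem_singleton.1 (h hV) ▸ hV

theorem card_lt_of_mem_blocks {π : NC n} (hπ : π ≠ one n) {V : Finset (Fin n)}
    (hV : V ∈ π.blocks) : V.card < n := by
  by_contra h
  have hVu : V = Finset.univ := by
    apply Finset.eq_univ_of_card
    have := Finset.card_le_univ V
    simp only [Fintype.card_fin] at *
    omega
  subst hVu
  apply hπ
  refine le_antisymm (le_one π) (le_iff.2 fun W _ => ⟨_, hV, Finset.subset_univ W⟩)

open Classical in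
/-- The interval below `π` in `NC n` is the product of the non-crossing partitions of the blocks
of `π`. -/
theorem prod_sum_ncParts {R : Type*} [CommRing R] (f : Finset (Fin n) → R) (π : NC n) :
    ∏ V ∈ π.blocks, ∑ σ ∈ ncParts V, ∏ W ∈ σ, f W =
      ∑ ρ ∈ Finset.univ.filter (· ≤ π), ∏ W ∈ ρ.blocks, f W := by
  have hπ := π.isNCPart_blocks
  -- The expanded product runs over choices of a partition of each block of `π`. The union of the
  -- choices is the corresponding `ρ ≤ π`, and each choice is recovered as the blocks of `ρ` inside
  -- `V`.
  rw [Finset.prod_sum]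
  have hmem : ∀ p ∈ π.blocks.pi ncParts, ∀ V, ∀ hV : V ∈ π.blocks, IsNCPart V ∅ (p V hV) :=
    fun p hp V hV => mem_ncParts.1 (Finset.mem_pi.1 hp V hV)
  have hunion : ∀ p ∈ π.blocks.pi ncParts, IsNCPart Finset.univ ∅
      (π.blocks.attach.biUnion fun V => p V.1 V.2) := by
    intro p hp
    have H := hmem p hp
    have hb : ∀ W, W ∈ (π.blocks.attach.biUnion fun V => p V.1 V.2) ↔
        ∃ V, ∃ hV : V ∈ π.blocks, W ∈ p V hV := by simp
    have same : ∀ V, ∀ hV : V ∈ π.blocks, ∀ V', ∀ hV' : V' ∈ π.blocks, ∀ x W W', W ∈ p V hV →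
        W' ∈ p V' hV' → x ∈ W → x ∈ W' → V = V' := fun V hV V' hV' x W W' hW hW' hx hx' =>
      hπ.eq_of_mem V hV V' hV' x ((H V hV).mem_base W hW x hx) ((H V' hV').mem_base W' hW' x hx')
    refine ⟨Finset.empty_subset _, ?_, fun _ _ _ _ => Finset.mem_univ _,
      fun _ _ _ _ => Finset.notMem_empty _, ?_, ?_, ?_, by simp⟩
    · intro W hW
      obtain ⟨V, hV, hW⟩ := (hb W).1 hW
      exact (H V hV).nonempty W hW
    · intro x _ _
      obtain ⟨V, hV, hx⟩ := hπ.cover x (Finset.mem_univ x) (Finset.notMem_empty x)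
      obtain ⟨W, hW, hxW⟩ := (H V hV).cover x hx (Finset.notMem_empty x)
      exact ⟨W, (hb W).2 ⟨V, hV, hW⟩, hxW⟩
    · intro W hW W' hW' x hx hx'
      obtain ⟨V, hV, hW⟩ := (hb W).1 hW
      obtain ⟨V', hV', hW'⟩ := (hb W').1 hW'
      obtain rfl := same V hV V' hV' x W W' hW hW' hx hx'
      exact (H V hV).eq_of_mem W hW W' hW' x hx hx'
    · intro W hW W' hW' hne a b c d hab hbc hcd ha hc hb' hd
      obtain ⟨V, hV, hW⟩ := (hb W).1 hW
      obtain ⟨V', hV', hW'⟩ := (hb W').1 hW'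
      by_cases hVV : V = V'
      · subst hVV
        exact (H V hV).noncrossing W hW W' hW' hne a b c d hab hbc hcd ha hc hb' hd
      · exact hπ.noncrossing V hV V' hV' hVV a b c d hab hbc hcd
          ((H V hV).mem_base W hW a ha) ((H V hV).mem_base W hW c hc)
          ((H V' hV').mem_base W' hW' b hb') ((H V' hV').mem_base W' hW' d hd)
  have hfilter : ∀ p ∈ π.blocks.pi ncParts, ∀ V, ∀ hV : V ∈ π.blocks,
      (π.blocks.attach.biUnion fun V => p V.1 V.2).filter (· ⊆ V) = p V hV := by
    intro p hp V hV
    have H := hmem p hp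
    ext W
    simp only [Finset.mem_filter, Finset.mem_biUnion, Finset.mem_attach, true_and, Subtype.exists]
    constructor
    · rintro ⟨⟨V', hV', hW⟩, hWV⟩
      obtain ⟨x, hx⟩ := (H V' hV').nonempty W hW
      obtain rfl := hπ.eq_of_mem V hV V' hV' x (hWV hx) ((H V' hV').mem_base W hW x hx)
      exact hW
    · intro hW
      exact ⟨⟨V, hV, hW⟩, fun x hx => (H V hV).mem_base W hW x hx⟩
  refine Finset.sum_bij' (fun p hp => ofBlocks _ (hunion p hp))
    (fun ρ _ V _ => ρ.blocks.filter (· ⊆ V)) ?_ ?_ ?_ ?_ ?_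
  · intro p hp
    refine Finset.mem_filter.2 ⟨Finset.mem_univ _, le_iff.2 fun W hW => ?_⟩
    rw [blocks_ofBlocks] at hW
    obtain ⟨V, -, hW⟩ := Finset.mem_biUnion.1 hW
    exact ⟨V.1, V.2, fun x hx => (hmem p hp V.1 V.2).mem_base W hW x hx⟩
  · intro ρ hρ
    have hle := le_iff.1 (Finset.mem_filter.1 hρ).2
    have hρ' := ρ.isNCPart_blocks
    refine Finset.mem_pi.2 fun V hV => mem_ncParts.2
      ⟨Finset.empty_subset _, ?_, ?_, fun _ _ _ _ => Finset.notMem_empty _, ?_, ?_, ?_, by simp⟩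
    · exact fun W hW => hρ'.nonempty W (Finset.mem_filter.1 hW).1
    · exact fun W hW x hx => (Finset.mem_filter.1 hW).2 hx
    · intro x hx _
      obtain ⟨W, hW, hxW⟩ := hρ'.cover x (Finset.mem_univ x) (Finset.notMem_empty x)
      obtain ⟨V', hV', hWV'⟩ := hle W hW
      obtain rfl := hπ.eq_of_mem V hV V' hV' x hx (hWV' hxW)
      exact ⟨W, Finset.mem_filter.2 ⟨hW, hWV'⟩, hxW⟩
    · exact fun W hW W' hW' => hρ'.eq_of_mem W (Finset.mem_filter.1 hW).1 W'
        (Finset.mem_filter.1 hW').1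
    · exact fun W hW W' hW' => hρ'.noncrossing W (Finset.mem_filter.1 hW).1 W'
        (Finset.mem_filter.1 hW').1
  · intro p hp
    funext V hV
    exact hfilter p hp V hV
  · intro ρ hρ
    have hle := le_iff.1 (Finset.mem_filter.1 hρ).2
    apply blocks_injective
    rw [blocks_ofBlocks]
    ext W
    simp only [Finset.mem_filter, Finset.mem_biUnion, Finset.mem_attach, true_and, Subtype.exists,
      exists_and_left, exists_prop]
    constructor
    · rintro ⟨h, -⟩
      exact h
    · intro hW
      obtain ⟨V, hV, hWV⟩ := hle W hW
      exact ⟨hW, V, hV, hWV⟩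
  · intro p hp
    rw [blocks_ofBlocks, Finset.prod_biUnion]
    intro V _ V' _ hne
    refine Finset.disjoint_left.2 fun W hW hW' => hne (Subtype.ext ?_)
    obtain ⟨x, hx⟩ := (hmem p hp V.1 V.2).nonempty W hW
    exact hπ.eq_of_mem V.1 V.2 V'.1 V'.2 x ((hmem p hp V.1 V.2).mem_base W hW x hx)
      ((hmem p hp V'.1 V'.2).mem_base W hW' x hx)

/-- Möbius inversion on `NC n` for families of sums over non-crossing partitions of blocks. -/
theorem sum_moebius_prod_sum_ncParts {R : Type*} [CommRing R] [Algebra ℂ R]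
    (f : Finset (Fin n) → R) (hn : 1 ≤ n) :
    ∑ π : NC n, algebraMap ℂ R (moebius π (one n)) *
      ∏ V ∈ π.blocks, ∑ σ ∈ ncParts V, ∏ W ∈ σ, f W = f Finset.univ := by
  classical
  simp_rw [prod_sum_ncParts, Finset.sum_filter, Finset.mul_sum]
  rw [Finset.sum_comm]
  -- The inner sum is that of `moebius π (one n)` over the interval from `ρ` to `one n`, so only `ρ
  -- = one n` contributes.
  have h : ∀ ρ : NC n, ∑ π : NC n, algebraMap ℂ R (moebius π (one n)) *
      (if ρ ≤ π then ∏ W ∈ ρ.blocks, f W else 0) =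
      if ρ = one n then ∏ W ∈ ρ.blocks, f W else 0 := by
    intro ρ
    have h1 : ∑ π ∈ Finset.Icc ρ (one n), moebius π (one n) = if ρ = one n then 1 else 0 :=
      IncidenceAlgebra.sum_Icc_mu_left (𝕜 := ℂ) ρ (one n)
    have h2 : Finset.Icc ρ (one n) = Finset.univ.filter (ρ ≤ ·) := by
      ext π; simp [le_one]
    simp_rw [mul_ite, mul_zero]
    rw [← Finset.sum_filter, ← Finset.sum_mul, ← map_sum, ← h2, h1]
    split_ifs <;> simp
  rw [Finset.sum_congr rfl fun ρ _ => h ρ, Finset.sum_ite_eq' Finset.univ (one n)]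
  simp [blocks_one hn]

end NC

/-! ### The stack model with prescribed cumulants -/

open Classical in
/-- Cutting the increasing enumeration of `S` in two amounts to choosing an initial segment. -/
theorem Finset.sum_range_sort_take_drop {ι M : Type*} [LinearOrder ι] [AddCommMonoid M]
    (S : Finset ι) (g : List ι → List ι → M) :
    ∑ r ∈ Finset.range (S.card + 1), g (S.sort.take r) (S.sort.drop r) =
      ∑ V ∈ S.powerset.filter (fun V => ∀ v ∈ V, ∀ s ∈ S \ V, v < s), g V.sort (S \ V).sort := by
  have hnd := S.sort_nodup (· ≤ ·)
  have hpw := S.pairwise_sort (· ≤ ·)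
  have htake : ∀ r, (S.sort.take r).toFinset.sort = S.sort.take r := fun r =>
    (List.toFinset_sort (· ≤ ·) (hnd.sublist (List.take_sublist _ _))).2
      (hpw.sublist (List.take_sublist _ _))
  have hdrop : ∀ r, (S.sort.drop r).toFinset.sort = S.sort.drop r := fun r =>
    (List.toFinset_sort (· ≤ ·) (hnd.sublist (List.drop_sublist _ _))).2
      (hpw.sublist (List.drop_sublist _ _))
  have hnd' : ∀ r, (S.sort.take r ++ S.sort.drop r).Nodup := fun r => by
    rwa [List.take_append_drop]
  have hpw' : ∀ r, (S.sort.take r ++ S.sort.drop r).Pairwise (· ≤ ·) := fun r => by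
    rwa [List.take_append_drop]
  have hmem : ∀ r x, x ∈ S ↔ x ∈ S.sort.take r ∨ x ∈ S.sort.drop r := fun r x => by
    rw [← List.mem_append, List.take_append_drop, Finset.mem_sort]
  have hcompl : ∀ r, S \ (S.sort.take r).toFinset = (S.sort.drop r).toFinset := by
    intro r
    ext x
    have hd : ∀ x ∈ S.sort.take r, x ∉ S.sort.drop r := fun x hx hx' =>
      (List.nodup_append.1 (hnd' r)).2.2 x hx x hx' rfl
    simp only [Finset.mem_sdiff, List.mem_toFinset, hmem r x]
    have := hd x
    tauto
  have hsplit : ∀ V ⊆ S, (∀ v ∈ V, ∀ s ∈ S \ V, v < s) → S.sort = V.sort ++ (S \ V).sort := by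
    intro V hV hlt
    have h1 : (V.sort ++ (S \ V).sort).Nodup := by
      refine List.nodup_append.2 ⟨V.sort_nodup _, (S \ V).sort_nodup _, fun x hx y hy => ?_⟩
      exact (hlt x ((Finset.mem_sort _).1 hx) y ((Finset.mem_sort _).1 hy)).ne
    have h2 : (V.sort ++ (S \ V).sort).Pairwise (· ≤ ·) := by
      refine List.pairwise_append.2 ⟨V.pairwise_sort _, (S \ V).pairwise_sort _, fun x hx y hy => ?_⟩
      exact (hlt x ((Finset.mem_sort _).1 hx) y ((Finset.mem_sort _).1 hy)).le
    rw [← (List.toFinset_sort (· ≤ ·) h1).2 h2]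
    congr 1
    ext x
    have := @hV x
    simp only [List.mem_toFinset, List.mem_append, Finset.mem_sort, Finset.mem_sdiff]
    tauto
  refine Finset.sum_bij' (fun r _ => (S.sort.take r).toFinset) (fun V _ => V.card) ?_ ?_ ?_ ?_ ?_
  · intro r _
    refine Finset.mem_filter.2 ⟨Finset.mem_powerset.2 fun x hx => ?_, fun v hv s hs => ?_⟩
    · exact (hmem r x).2 (Or.inl (List.mem_toFinset.1 hx))
    · rw [hcompl] at hs
      have hv := List.mem_toFinset.1 hv
      have hs := List.mem_toFinset.1 hs
      exact lt_of_le_of_ne ((List.pairwise_append.1 (hpw' r)).2.2 v hv s hs)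
        ((List.nodup_append.1 (hnd' r)).2.2 v hv s hs)
  · intro V hV
    have := Finset.card_le_card (Finset.mem_powerset.1 (Finset.mem_filter.1 hV).1)
    exact Finset.mem_range.2 (by omega)
  · intro r hr
    have := Finset.mem_range.1 hr
    rw [← Finset.length_sort (· ≤ ·), htake, List.length_take, Finset.length_sort]
    omega
  · intro V hV
    have hV := Finset.mem_filter.1 hV
    rw [hsplit V (Finset.mem_powerset.1 hV.1) hV.2, List.take_left' (Finset.length_sort _),
      Finset.sort_toFinset]
  · intro r _
    rw [hcompl, htake, hdrop]

namespace Fock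

variable {R Y : Type*} [CommRing R]

/-- The operator by which a letter `x` acts on stacks of open letters: `x` is put on the stack,
or it closes a block with an initial part of the stack, weighted by `c`. -/
noncomputable def letter (c : List Y → R) (x : Y) : Module.End R (List Y →₀ R) :=
  Finsupp.linearCombination R fun s => Finsupp.single (x :: s) (1 : R) +
    ∑ r ∈ Finset.range (s.length + 1), Finsupp.single (s.drop r) (c (x :: s.take r))

theorem letter_single (c : List Y → R) (x : Y) (s : List Y) (w : R) :
    letter c x (Finsupp.single s w) = Finsupp.single (x :: s) w +
      ∑ r ∈ Finset.range (s.length + 1),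
        Finsupp.single (s.drop r) (w * c (x :: s.take r)) := by
  simp [letter, Finsupp.linearCombination_single, Finset.smul_sum]

open Classical in
/-- Words act on the vacuum by a sum over partial non-crossing partitions. -/
theorem prod_letter_sort {ι : Type*} [LinearOrder ι] [Fintype ι] (c : List Y → R) (y : ι → Y)
    (T : Finset ι) :
    (T.sort.map fun t => letter c (y t)).prod (Finsupp.single [] 1) =
      ∑ z ∈ Finset.univ.filter (fun z : Finset ι × Finset (Finset ι) => IsNCPart T z.1 z.2),
        Finsupp.single (z.1.sort.map y) (∏ V ∈ z.2, c (V.sort.map y)) := by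
  -- The rightmost letter acts first, so the new letter is the least one, and a stack lists its open
  -- points in increasing order from the top.
  induction T using Finset.induction_on_min with
  | empty =>
    have : Finset.univ.filter (fun z : Finset ι × Finset (Finset ι) =>
        IsNCPart ∅ z.1 z.2) = {(∅, ∅)} := by
      ext ⟨S, π⟩
      simp only [Finset.mem_filter, Finset.mem_univ, true_and, Finset.mem_singleton, Prod.mk.injEq]
      exact ⟨fun h => h.eq_empty_of_empty, by rintro ⟨rfl, rfl⟩; exact IsNCPart.empty⟩
    simp [this]
  | insert a T ha ih =>
    have haT : a ∉ T := fun h => lt_irrefl _ (ha a h)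
    have hsort : ∀ V ⊆ T, (insert a V).sort = a :: V.sort := fun V hV =>
      Finset.sort_insert _ (fun b hb => (ha b (hV hb)).le) (fun h => haT (hV h))
    rw [hsort T subset_rfl, List.map_cons, List.prod_cons, Module.End.mul_apply, ih, map_sum]
    have hstep : ∀ z ∈ Finset.univ.filter (fun z : Finset ι × Finset (Finset ι) =>
        IsNCPart T z.1 z.2),
        letter c (y a) (Finsupp.single (z.1.sort.map y) (∏ V ∈ z.2, c (V.sort.map y))) =
        Finsupp.single ((insert a z.1).sort.map y) (∏ V ∈ z.2, c (V.sort.map y)) +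
        ∑ V₀ ∈ z.1.powerset.filter (fun V => ∀ v ∈ V, ∀ s ∈ z.1 \ V, v < s),
          Finsupp.single ((z.1 \ V₀).sort.map y)
            (∏ V ∈ insert (insert a V₀) z.2, c (V.sort.map y)) := by
      rintro ⟨S, π⟩ hz
      have hz : IsNCPart T S π := (Finset.mem_filter.1 hz).2
      rw [letter_single, hsort S hz.subset_base, List.map_cons, List.length_map,
        Finset.length_sort]
      congr 1
      simp only [← List.map_drop, ← List.map_take]
      set w := ∏ V ∈ π, c (V.sort.map y) with hw
      rw [Finset.sum_range_sort_take_drop S (fun l l' => Finsupp.single (l'.map y)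
        (w * c (y a :: l.map y)))]
      refine Finset.sum_congr (by congr) fun V₀ hV₀ => ?_
      have hV₀S := Finset.mem_powerset.1 (Finset.mem_filter.1 hV₀).1
      rw [Finset.prod_insert, hsort V₀ (hV₀S.trans hz.subset_base), List.map_cons, mul_comm, hw]
      exact fun h => haT (hz.mem_base _ h a (Finset.mem_insert_self _ _))
    -- In a partial partition of `insert a T`, either `a` is open (the letter was put on the stack)
    -- or it is the least point of a block (the letter closed that block). The two sums match these
    -- cases.
    rw [Finset.sum_congr rfl hstep, Finset.sum_add_distrib, Finset.sum_sigma',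
      ← Finset.sum_filter_add_sum_filter_not (Finset.univ.filter
        (fun z : Finset ι × Finset (Finset ι) => IsNCPart (insert a T) z.1 z.2))
        (fun z => a ∈ z.1)]
    congr 1
    · refine Finset.sum_bij' (fun z _ => (insert a z.1, z.2)) (fun z _ => (z.1.erase a, z.2))
        ?_ ?_ ?_ ?_ ?_
      · rintro ⟨S, π⟩ hz
        have hz : IsNCPart T S π := (Finset.mem_filter.1 hz).2
        simpa using hz.push ha
      · rintro ⟨S, π⟩ hz
        simp only [Finset.mem_filter, Finset.mem_univ, true_and] at hz ⊢
        exact hz.1.unpush ha hz.2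
      · rintro ⟨S, π⟩ hz
        have hz : IsNCPart T S π := (Finset.mem_filter.1 hz).2
        simp [Finset.erase_insert fun h => haT (hz.subset_base h)]
      · rintro ⟨S, π⟩ hz
        simp only [Finset.mem_filter, Finset.mem_univ, true_and] at hz
        simp [Finset.insert_erase hz.2]
      · intros; rfl
    · have hblock : ∀ z ∈ (Finset.univ.filter (fun z : Finset ι × Finset (Finset ι) =>
          IsNCPart (insert a T) z.1 z.2)).filter (fun z => a ∉ z.1),
          ∃ V ∈ z.2, a ∈ V := fun z hz => by
        simp only [Finset.mem_filter, Finset.mem_univ, true_and] at hz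
        exact hz.1.cover a (Finset.mem_insert_self _ _) hz.2
      choose! B hB haB using hblock
      refine Finset.sum_bij'
        (fun q _ => (q.1.1 \ q.2, insert (insert a q.2) q.1.2))
        (fun z _ => ⟨(z.1 ∪ (B z).erase a, z.2.erase (B z)), (B z).erase a⟩) ?_ ?_ ?_ ?_ ?_
      · rintro ⟨⟨S, π⟩, V₀⟩ hq
        simp only [Finset.mem_sigma, Finset.mem_filter, Finset.mem_univ, true_and,
          Finset.mem_powerset] at hq ⊢
        refine ⟨hq.1.close ha hq.2.1 hq.2.2, fun h => haT (hq.1.subset_base ?_)⟩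
        exact (Finset.mem_sdiff.1 h).1
      · intro z hz
        have hBz := hB z hz
        have haBz := haB z hz
        simp only [Finset.mem_sigma, Finset.mem_filter, Finset.mem_univ, true_and,
          Finset.mem_powerset] at hz ⊢
        refine ⟨hz.1.open_block ha hBz haBz, Finset.subset_union_right, fun v hv s hs => ?_⟩
        refine hz.1.lt_of_mem_block ha hBz haBz v (Finset.mem_of_mem_erase hv) s ?_
        grind
      · rintro ⟨⟨S, π⟩, V₀⟩ hq
        have hmem : ((S \ V₀, insert (insert a V₀) π) : Finset ι × Finset (Finset ι)) ∈
            (Finset.univ.filter (fun z : Finset ι × Finset (Finset ι) =>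
            IsNCPart (insert a T) z.1 z.2)).filter (fun z => a ∉ z.1) := by
          simp only [Finset.mem_sigma, Finset.mem_filter, Finset.mem_univ, true_and,
            Finset.mem_powerset] at hq ⊢
          refine ⟨hq.1.close ha hq.2.1 hq.2.2, fun h => haT (hq.1.subset_base ?_)⟩
          exact (Finset.mem_sdiff.1 h).1
        have hBz := hB _ hmem
        have haBz := haB _ hmem
        simp only [Finset.mem_sigma, Finset.mem_filter, Finset.mem_univ, true_and,
          Finset.mem_powerset] at hq hmem
        -- Only one block contains `a`, so the chosen block is the one just closed.
        have hV₀ : B (S \ V₀, insert (insert a V₀) π) = insert a V₀ :=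
          hmem.1.eq_of_mem _ hBz _ (Finset.mem_insert_self _ _) a haBz
            (Finset.mem_insert_self _ _)
        have haV₀ : a ∉ V₀ := fun h => haT (hq.1.subset_base (hq.2.1 h))
        have hπ : insert a V₀ ∉ π := fun h =>
          haT (hq.1.mem_base _ h a (Finset.mem_insert_self _ _))
        simp only [hV₀, Finset.erase_insert haV₀, Finset.erase_insert hπ,
          Finset.sdiff_union_of_subset hq.2.1]
      · intro z hz
        have hBz := hB z hz
        have haBz := haB z hz
        simp only [Finset.mem_filter, Finset.mem_univ, true_and] at hz
        rw [Finset.insert_erase haBz, Finset.insert_erase hBz]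
        refine Prod.ext ?_ rfl
        have hd : ∀ x ∈ (B z).erase a, x ∉ z.1 := fun x hx =>
          hz.1.notMem_open _ hBz x (Finset.mem_of_mem_erase hx)
        ext x
        have := hd x
        simp only [Finset.mem_sdiff, Finset.mem_union]
        tauto
      · intros; rfl

variable [Algebra ℂ R]

/-- The representation of the free algebra on stacks. -/
noncomputable def rep (c : List Y → R) : FreeAlgebra ℂ Y →ₐ[ℂ] Module.End R (List Y →₀ R) :=
  FreeAlgebra.lift ℂ (letter c)

/-- The vacuum state of the representation `rep c`. -/
noncomputable def state (c : List Y → R) : FreeAlgebra ℂ Y →ₗ[ℂ] R where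
  toFun p := rep c p (Finsupp.single [] 1) []
  map_add' p q := by simp
  map_smul' z p := by simp

theorem state_apply (c : List Y → R) (p : FreeAlgebra ℂ Y) :
    state c p = rep c p (Finsupp.single [] 1) [] := rfl

theorem rep_ι (c : List Y → R) (x : Y) : rep c (FreeAlgebra.ι ℂ x) = letter c x := by
  simp [rep]

theorem state_one (c : List Y → R) : state c 1 = 1 := by
  simp [state_apply]

/-- The moments of the vacuum state are sums of products of `c` over non-crossing partitions. -/
theorem state_prod_sort {ι : Type*} [LinearOrder ι] [Fintype ι] (c : List Y → R) (y : ι → Y)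
    (T : Finset ι) :
    state c (T.sort.map fun t => FreeAlgebra.ι ℂ (y t)).prod =
      ∑ π ∈ ncParts T, ∏ V ∈ π, c (V.sort.map y) := by
  classical
  rw [state_apply, map_list_prod, List.map_map]
  have : (rep c ∘ fun t => FreeAlgebra.ι ℂ (y t)) = fun t => letter c (y t) :=
    funext fun t => rep_ι c (y t)
  rw [this, prod_letter_sort, Finsupp.finsetSum_apply, ncParts]
  -- Taking the coefficient of the empty stack keeps exactly the partitions without open points.
  have hnil : ∀ S : Finset ι, S.sort.map y = [] ↔ S = ∅ := fun S => by
    rw [← List.length_eq_zero_iff, List.length_map, Finset.length_sort, Finset.card_eq_zero]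
  simp only [Finsupp.single_apply, hnil]
  rw [← Finset.sum_filter, Finset.filter_filter]
  refine Finset.sum_bij' (fun z _ => z.2) (fun π _ => (∅, π)) ?_ ?_ ?_ ?_ ?_
  · rintro ⟨S, π⟩ h
    simp only [Finset.mem_filter, Finset.mem_univ, true_and] at h ⊢
    exact h.2 ▸ h.1
  · intro π h
    simpa using h
  · rintro ⟨S, π⟩ h
    simp only [Finset.mem_filter, Finset.mem_univ, true_and] at h ⊢
    rw [h.2]
  · intros; rfl
  · intros; rfl

/-- The function `c` gives the non-crossing cumulants of the vacuum state. -/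
theorem sum_moebius_state {n : ℕ} (hn : 1 ≤ n) (c : List Y → R) (y : Fin n → Y) :
    ∑ π : NC n, algebraMap ℂ R (NC.moebius π (NC.one n)) *
      ∏ V ∈ π.blocks, state c (V.sort.map fun t => FreeAlgebra.ι ℂ (y t)).prod =
      c (List.ofFn y) := by
  simp_rw [state_prod_sort]
  have h := NC.sum_moebius_prod_sum_ncParts (fun V : Finset (Fin n) => c (V.sort.map y)) hn
  rwa [Fin.sort_univ, ← List.ofFn_eq_map] at h

end Fock

/-! ### Coloured letters and freeness of the model -/

namespace Fock

variable {R Y K : Type*} [CommRing R]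

/-- Stacks all of whose letters have colour `i`. -/
noncomputable def monochrome (R : Type*) [CommRing R] (col : Y → K) (i : K) :
    Submodule R (List Y →₀ R) :=
  Finsupp.supported R R {s | ∀ z ∈ s, col z = i}

/-- The map putting `s` at the bottom of a stack. -/
noncomputable def append (R : Type*) [CommRing R] (s : List Y) :
    (List Y →₀ R) →ₗ[R] (List Y →₀ R) :=
  Finsupp.lmapDomain R R (· ++ s)

theorem append_single (s u : List Y) (w : R) :
    append R s (Finsupp.single u w) = Finsupp.single (u ++ s) w := by
  simp [append, Finsupp.lmapDomain_apply, Finsupp.mapDomain_single]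

variable {c : List Y → R} {col : Y → K}

/-- A block reaching into `s` would contain the top letter of `s`, of another colour, and so has
weight zero. Thus `s` stays inert under the letters above it. -/
theorem letter_monochrome_append (hc : ∀ x s, (∃ z ∈ s, col z ≠ col x) → c (x :: s) = 0)
    (x : Y) {v : List Y →₀ R} (hv : v ∈ monochrome R col (col x)) :
    letter c x v ∈ monochrome R col (col x) ∧
      ∀ s : List Y, (∀ z ∈ s.head?, col z ≠ col x) →
        letter c x (append R s v) = append R s (letter c x v) := by
  constructor
  · revert v
    change monochrome R col (col x) ≤ (monochrome R col (col x)).comap (letter c x)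
    rw [monochrome, Finsupp.supported_eq_span_single, Submodule.span_le]
    rintro _ ⟨u, hu, rfl⟩
    rw [← Finsupp.supported_eq_span_single, SetLike.mem_coe, Submodule.mem_comap]
    dsimp only
    rw [letter_single]
    refine Submodule.add_mem _ (Finsupp.single_mem_supported R _ ?_)
      (Submodule.sum_mem _ fun r _ => Finsupp.single_mem_supported R _ ?_)
    · intro z hz
      rcases List.mem_cons.1 hz with rfl | hz
      · rfl
      · exact hu z hz
    · exact fun z hz => hu z (List.mem_of_mem_drop hz)
  · intro s hs
    revert v
    change monochrome R col (col x) ≤ LinearMap.eqLocus (letter c x ∘ₗ append R s)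
      (append R s ∘ₗ letter c x)
    rw [monochrome, Finsupp.supported_eq_span_single, Submodule.span_le]
    rintro _ ⟨u, hu, rfl⟩
    rw [SetLike.mem_coe, LinearMap.mem_eqLocus]
    simp only [LinearMap.comp_apply, append_single, letter_single, map_add, map_sum,
      List.cons_append]
    congr 1
    have hsub : Finset.range (u.length + 1) ⊆ Finset.range ((u ++ s).length + 1) := by
      rw [Finset.range_subset_range, List.length_append]
      omega
    rw [← Finset.sum_subset hsub]
    · refine Finset.sum_congr rfl fun r hr => ?_
      have hr := Finset.mem_range.1 hr
      rw [List.drop_append_of_le_length (by omega), List.take_append_of_le_length (by omega)]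
    · intro r hr hr'
      rw [Finset.mem_range, List.length_append] at hr
      rw [Finset.mem_range] at hr'
      have hzero : c (x :: (u ++ s).take r) = 0 := by
        rcases s with _ | ⟨z, s⟩
        · simp at hr
          omega
        · refine hc _ _ ⟨z, ?_, hs z rfl⟩
          rw [List.take_append]
          obtain ⟨m, hm⟩ : ∃ m, r - u.length = m + 1 := ⟨r - u.length - 1, by omega⟩
          simp [hm]
      simp [hzero]

variable [Algebra ℂ R]

/-- Both conclusions are proved together because a product needs the first: `q` keeps `v`
monochrome, after which the claim for `p` applies. -/
theorem rep_monochrome_append (hc : ∀ x s, (∃ z ∈ s, col z ≠ col x) → c (x :: s) = 0)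
    {i : K} {p : FreeAlgebra ℂ Y}
    (hp : p ∈ Algebra.adjoin ℂ (FreeAlgebra.ι ℂ '' {y | col y = i})) :
    ∀ v ∈ monochrome R col i, rep c p v ∈ monochrome R col i ∧
      ∀ s : List Y, (∀ z ∈ s.head?, col z ≠ i) →
        rep c p (append R s v) = append R s (rep c p v) := by
  induction hp using Algebra.adjoin_induction with
  | mem p hp =>
    obtain ⟨x, rfl, rfl⟩ := hp
    intro v hv
    rw [rep_ι]
    exact letter_monochrome_append hc x hv
  | algebraMap r =>
    intro v hv
    simp only [AlgHom.commutes, Module.algebraMap_end_apply]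
    rw [← algebraMap_smul R r]
    refine ⟨Submodule.smul_mem _ _ hv, fun s _ => ?_⟩
    rw [← algebraMap_smul R r, map_smul]
  | add p q _ _ hp hq =>
    intro v hv
    simp only [map_add, LinearMap.add_apply]
    refine ⟨Submodule.add_mem _ (hp v hv).1 (hq v hv).1, fun s hs => ?_⟩
    rw [(hp v hv).2 s hs, (hq v hv).2 s hs]
  | mul p q _ _ hp hq =>
    intro v hv
    simp only [map_mul, Module.End.mul_apply]
    have hqv := hq v hv
    refine ⟨(hp _ hqv.1).1, fun s hs => ?_⟩
    rw [hqv.2 s hs, (hp _ hqv.1).2 s hs]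

/-- On a stack `s` with top not of colour `i`, `p` acts as on the vacuum with `s` placed underneath.
Centring removes the empty stack from the vacuum image, leaving at least one letter of colour `i` on
top of `s`. -/
theorem centred_mem_supported (hc : ∀ x s, (∃ z ∈ s, col z ≠ col x) → c (x :: s) = 0)
    {i : K} {p : FreeAlgebra ℂ Y}
    (hp : p ∈ Algebra.adjoin ℂ (FreeAlgebra.ι ℂ '' {y | col y = i})) {v : List Y →₀ R}
    (hv : v ∈ Finsupp.supported R R {s : List Y | ∀ z ∈ s.head?, col z ≠ i}) :
    (rep c p - state c p • 1) v ∈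
      Finsupp.supported R R {s : List Y | s.head?.map col = some i} := by
  revert v
  change Finsupp.supported R R _ ≤ (Finsupp.supported R R _).comap (rep c p - state c p • 1)
  rw [Finsupp.supported_eq_span_single, Submodule.span_le]
  rintro _ ⟨s, hs, rfl⟩
  rw [SetLike.mem_coe, Submodule.mem_comap]
  have hΩ : Finsupp.single ([] : List Y) (1 : R) ∈ monochrome R col i :=
    Finsupp.single_mem_supported R _ (by simp)
  obtain ⟨h1, h2⟩ := rep_monochrome_append hc hp _ hΩ
  set w := (rep c p - state c p • 1) (Finsupp.single [] 1) with hw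
  have hws : (rep c p - state c p • 1) (Finsupp.single s 1) = append R s w := by
    have hs' : Finsupp.single s (1 : R) = append R s (Finsupp.single [] 1) := by
      rw [append_single, List.nil_append]
    rw [hw, hs']
    simp only [LinearMap.sub_apply, LinearMap.smul_apply, Module.End.one_apply, map_sub, map_smul,
      h2 s hs]
  have hwmem : w ∈ monochrome R col i := by
    rw [hw]
    simp only [LinearMap.sub_apply, LinearMap.smul_apply, Module.End.one_apply]
    exact Submodule.sub_mem _ h1 (Submodule.smul_mem _ _ hΩ)
  have hwnil : w [] = 0 := by
    simp [hw, state_apply]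
  dsimp only
  rw [hws]
  classical
  rw [Finsupp.mem_supported]
  intro t ht
  obtain ⟨u, hu, rfl⟩ := Finset.mem_image.1 (Finsupp.mapDomain_support (Finset.mem_coe.1 ht))
  rcases u with _ | ⟨z, u⟩
  · exact absurd hwnil (Finsupp.mem_support_iff.1 hu)
  · have := (Finsupp.mem_supported R w).1 hwmem (Finset.mem_coe.2 hu) z List.mem_cons_self
    simpa using this

/-- Alternation ensures that the output of each factor is an admissible input for the next factor to
the left. -/
theorem prod_centred_mem_supported
    (hc : ∀ x s, (∃ z ∈ s, col z ≠ col x) → c (x :: s) = 0)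
    (l : List (K × FreeAlgebra ℂ Y)) (hl : l.IsChain fun q q' => q.1 ≠ q'.1)
    (hmem : ∀ q ∈ l, q.2 ∈ Algebra.adjoin ℂ (FreeAlgebra.ι ℂ '' {y | col y = q.1})) :
    (l.map fun q => rep c q.2 - state c q.2 • 1).prod (Finsupp.single [] 1) ∈
      Finsupp.supported R R {s : List Y | s.head?.map col = l.head?.map Prod.fst} := by
  induction l with
  | nil => exact Finsupp.single_mem_supported R _ (by simp)
  | cons q l ih =>
    rw [List.map_cons, List.prod_cons, Module.End.mul_apply]
    refine centred_mem_supported hc (hmem q List.mem_cons_self) (Finsupp.supported_mono ?_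
      (ih hl.tail fun q' hq' => hmem q' (List.mem_cons_of_mem _ hq')))
    intro s hs z hz hzq
    rcases l with _ | ⟨q', l⟩
    · simp at hs
      simp [hs] at hz
    · have hne : q.1 ≠ q'.1 := (List.isChain_cons_cons.1 hl).1
      rw [Option.mem_def] at hz
      have : col z = q'.1 := by simpa [hz] using hs
      exact hne (hzq.symm.trans this)

theorem prod_centred_vacuum
    (hc : ∀ x s, (∃ z ∈ s, col z ≠ col x) → c (x :: s) = 0)
    (l : List (K × FreeAlgebra ℂ Y)) (hne : l ≠ []) (hl : l.IsChain fun q q' => q.1 ≠ q'.1)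
    (hmem : ∀ q ∈ l, q.2 ∈ Algebra.adjoin ℂ (FreeAlgebra.ι ℂ '' {y | col y = q.1})) :
    (l.map fun q => rep c q.2 - state c q.2 • 1).prod (Finsupp.single [] 1) [] = 0 := by
  by_contra h
  have := (Finsupp.mem_supported R _).1 (prod_centred_mem_supported hc l hl hmem)
    (Finset.mem_coe.2 (Finsupp.mem_support_iff.2 h))
  rcases l with _ | ⟨q, l⟩
  · exact hne rfl
  · simp at this

end Fock

/-! ### First-order expansion over the dual numbers -/

/-- Expansion of a product of first-order perturbations. -/
theorem List.prod_map_sub_smul_one {R E Q : Type*} [CommRing R] [Ring E] [Algebra R E]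
    (f : Q → E) (e : Q → R) (l : List Q) (he : ∀ q ∈ l, ∀ q' ∈ l, e q * e q' = 0) :
    (l.map fun q => f q - e q • 1).prod = (l.map f).prod -
      ∑ j ∈ Finset.range l.length, (l.map e).getD j 0 • ((l.eraseIdx j).map f).prod := by
  induction l with
  | nil => simp
  | cons q l ih =>
    -- This kills every term in which two factors are replaced by scalars. Indices out of range
    -- contribute the default `0`.
    have hz : ∀ j, (l.map e).getD j 0 * e q = 0 := by
      intro j
      by_cases hj : j < l.length
      · rw [List.getD_eq_getElem _ _ (by simpa using hj), List.getElem_map]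
        exact he _ (List.mem_cons_of_mem _ (List.getElem_mem hj)) _ List.mem_cons_self
      · rw [List.getD_eq_default _ _ (by simpa using hj), zero_mul]
    rw [List.map_cons, List.prod_cons, ih fun a ha b hb =>
      he a (List.mem_cons_of_mem _ ha) b (List.mem_cons_of_mem _ hb), List.length_cons,
      Finset.sum_range_succ']
    simp only [List.map_cons, List.prod_cons, List.eraseIdx_cons_succ, List.getD_cons_succ,
      List.eraseIdx_cons_zero, List.getD_cons_zero, sub_mul, mul_sub, Finset.mul_sum,
      mul_smul_comm, smul_mul_assoc, one_mul, smul_sub, smul_smul, hz, zero_smul, sub_zero]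
    abel

namespace Fock

variable {Y K : Type*} {c : List Y → DualNumber ℂ} {col : Y → K}

/-- The hypothesis `hcen` makes each `state c q.2` a multiple of `ε`, so the fully centred product,
whose vacuum coefficient is zero, expands to first order only. -/
theorem state_prod_of_centred
    (hc : ∀ x s, (∃ z ∈ s, col z ≠ col x) → c (x :: s) = 0)
    (l : List (K × FreeAlgebra ℂ Y)) (hne : l ≠ []) (hl : l.IsChain fun q q' => q.1 ≠ q'.1)
    (hmem : ∀ q ∈ l, q.2 ∈ Algebra.adjoin ℂ (FreeAlgebra.ι ℂ '' {y | col y = q.1}))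
    (hcen : ∀ q ∈ l, (state c q.2).fst = 0) :
    state c (l.map Prod.snd).prod = ∑ j ∈ Finset.range l.length,
      (l.map fun q => state c q.2).getD j 0 * state c ((l.eraseIdx j).map Prod.snd).prod := by
  have h := prod_centred_vacuum hc l hne hl hmem
  rw [List.prod_map_sub_smul_one (fun q : K × FreeAlgebra ℂ Y => rep c q.2)
    (fun q => state c q.2)] at h
  · have hrep : ∀ l' : List (K × FreeAlgebra ℂ Y), (l'.map fun q => rep c q.2).prod =
        rep c (l'.map Prod.snd).prod := fun l' => by rw [map_list_prod, List.map_map]; rfl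
    simp only [hrep, LinearMap.sub_apply, LinearMap.sum_apply, LinearMap.smul_apply,
      Finsupp.sub_apply, Finsupp.finsetSum_apply, Finsupp.smul_apply, ← state_apply,
      smul_eq_mul, sub_eq_zero] at h
    exact h
  · intro q hq q' hq'
    ext <;> simp [hcen q hq, hcen q' hq']

end Fock

/-! ### Collapsing nested words and the infinitesimal formula -/

/-- The value of a centred functional `f`, free with respect to a colouring, on a product of two
alternating words, the first of which is given in reverse order. -/
noncomputable def nestedMoment {A K : Type*} [Ring A] [Algebra ℂ A] (f : A →ₗ[ℂ] ℂ) :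
    List (K × A) → List (K × A) → ℂ
  | [], [] => 1
  | x :: L, y :: L' =>
    open Classical in if x.1 = y.1 then f (x.2 * y.2) * nestedMoment f L L' else 0
  | [], _ :: _ => 0
  | _ :: _, [] => 0

section

variable {A K : Type*} [Ring A] [Algebra ℂ A]

/-- The letters `x`, `y` at the junction come first in both lists. If their colours differ, the
whole word is alternating and centred. If they agree, replacing `x.2 * y.2` by its centring gives an
alternating centred word, so only `f (x.2 * y.2)` times the word without both letters remains. -/
theorem prod_eq_nestedMoment {f : A →ₗ[ℂ] ℂ} (hf : f 1 = 1) {B : K → Subalgebra ℂ A}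
    (hfree : ∀ l : List (K × A), l ≠ [] → (l.IsChain fun q q' => q.1 ≠ q'.1) →
      (∀ q ∈ l, q.2 ∈ B q.1) → (∀ q ∈ l, f q.2 = 0) → f (l.map Prod.snd).prod = 0)
    (L L' : List (K × A)) (hL : L.IsChain fun q q' => q.1 ≠ q'.1)
    (hL' : L'.IsChain fun q q' => q.1 ≠ q'.1)
    (hLB : ∀ q ∈ L, q.2 ∈ B q.1) (hLB' : ∀ q ∈ L', q.2 ∈ B q.1)
    (hLc : ∀ q ∈ L, f q.2 = 0) (hLc' : ∀ q ∈ L', f q.2 = 0) :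
    f ((L.reverse.map Prod.snd).prod * (L'.map Prod.snd).prod) = nestedMoment f L L' := by
  induction L generalizing L' with
  | nil =>
    rcases L' with _ | ⟨y, L'⟩
    · simp [nestedMoment, hf]
    · have := hfree (y :: L') (by simp) hL' hLB' hLc'
      simpa [nestedMoment] using this
  | cons x L ih =>
    have hrev : ∀ {l : List (K × A)}, (l.IsChain fun q q' => q.1 ≠ q'.1) →
        l.reverse.IsChain fun q q' => q.1 ≠ q'.1 := fun h =>
      List.isChain_reverse.2 (h.imp fun _ _ => Ne.symm)
    rcases L' with _ | ⟨y, L'⟩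
    · have := hfree (x :: L).reverse (by simp) (hrev hL)
        (fun q hq => hLB q (List.mem_reverse.1 hq)) (fun q hq => hLc q (List.mem_reverse.1 hq))
      simpa [nestedMoment] using this
    · have hxL : ∀ z ∈ L.head?, x.1 ≠ z.1 := fun z hz => (List.isChain_cons.1 hL).1 z hz
      have hyL : ∀ z ∈ L'.head?, y.1 ≠ z.1 := fun z hz => (List.isChain_cons.1 hL').1 z hz
      rw [nestedMoment]
      split_ifs with hxy
      · have ih := ih L' hL.tail hL'.tail (fun q hq => hLB q (List.mem_cons_of_mem _ hq))
          (fun q hq => hLB' q (List.mem_cons_of_mem _ hq))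
          (fun q hq => hLc q (List.mem_cons_of_mem _ hq))
          (fun q hq => hLc' q (List.mem_cons_of_mem _ hq))
        set z : K × A := (x.1, x.2 * y.2 - f (x.2 * y.2) • 1) with hz
        have hzero := hfree (L.reverse ++ z :: L') (by simp) ?_ ?_ ?_
        · rw [← ih, ← sub_eq_zero, ← smul_eq_mul (f (x.2 * y.2)), ← map_smul, ← map_sub, ← hzero]
          simp [hz, mul_sub, sub_mul, mul_assoc]
        · refine List.isChain_append.2 ⟨hrev hL.tail, List.isChain_cons.2
            ⟨fun w hw => by rw [hz]; exact hxy ▸ hyL w hw, hL'.tail⟩, ?_⟩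
          intro u hu v hv
          rw [List.getLast?_reverse] at hu
          simp only [List.head?_cons, Option.mem_def, Option.some.injEq] at hv
          subst hv
          exact (hxL u hu).symm
        · intro q hq
          rcases List.mem_append.1 hq with hq | hq
          · exact hLB q (List.mem_cons_of_mem _ (List.mem_reverse.1 hq))
          · rcases List.mem_cons.1 hq with rfl | hq
            · exact Subalgebra.sub_mem _ (Subalgebra.mul_mem _ (hLB x List.mem_cons_self)
                (hxy ▸ hLB' y List.mem_cons_self)) (Subalgebra.smul_mem _ (Subalgebra.one_mem _) _)
            · exact hLB' q (List.mem_cons_of_mem _ hq)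
        · intro q hq
          rcases List.mem_append.1 hq with hq | hq
          · exact hLc q (List.mem_cons_of_mem _ (List.mem_reverse.1 hq))
          · rcases List.mem_cons.1 hq with rfl | hq
            · simp [hz, hf]
            · exact hLc' q (List.mem_cons_of_mem _ hq)
      · have := hfree ((x :: L).reverse ++ y :: L') (by simp) ?_ ?_ ?_
        · rwa [List.map_append, List.prod_append] at this
        · refine List.isChain_append.2 ⟨hrev hL, hL', ?_⟩
          intro u hu v hv
          rw [List.getLast?_reverse] at hu
          simp only [List.head?_cons, Option.mem_def, Option.some.injEq] at hu hv
          subst hu hv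
          exact hxy
        · intro q hq
          rcases List.mem_append.1 hq with hq | hq
          · exact hLB q (List.mem_reverse.1 hq)
          · exact hLB' q hq
        · intro q hq
          rcases List.mem_append.1 hq with hq | hq
          · exact hLc q (List.mem_reverse.1 hq)
          · exact hLc' q hq

open Classical in
-- Paired positions have constant sum `m + j - 1`; the induction peels off the innermost pair.
theorem nestedMoment_range (f : A →ₗ[ℂ] ℂ) (g : ℕ → K × A) (j m r : ℕ) :
    nestedMoment f ((List.range j).map g).reverse ((List.range' m r).map g) =
      if r = j ∧ ∀ q < j, (g q).1 = (g (m + j - 1 - q)).1 then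
        ∏ q ∈ Finset.range j, f ((g q).2 * (g (m + j - 1 - q)).2) else 0 := by
  induction j generalizing m r with
  | zero => rcases r with _ | r <;> simp [nestedMoment, List.range'_succ]
  | succ j ih =>
    rcases r with _ | r
    · simp [nestedMoment, List.range_succ]
    · have e1 : m + (j + 1) - 1 - j = m := by omega
      have e2 : ∀ q, m + 1 + j - 1 - q = m + (j + 1) - 1 - q := fun q => by omega
      rw [List.range_succ, List.map_append, List.reverse_append, List.range'_succ]
      simp only [List.map_cons, List.map_nil, List.reverse_singleton, List.singleton_append,
        nestedMoment, ih, e2, Finset.prod_range_succ, e1, Nat.lt_succ_iff_lt_or_eq, or_imp,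
        forall_and, forall_eq, Nat.add_right_cancel_iff]
      by_cases h1 : r = j <;> by_cases h2 : (g j).1 = (g m).1 <;> simp [h1, h2, mul_comm]

end

namespace Incps

variable {A : Type*} [Ring A] [Algebra ℂ A]

/-- Removing letter `j` leaves words of lengths `j` and `n - 1 - j` on the two sides. Their nested
moment vanishes unless the lengths agree and the colours mirror each other, so at most the middle
letter contributes. -/
theorem infinitesimallyFree_of_prod_eq (P : Incps A) {k : ℕ} {B : Fin k → Subalgebra ℂ A}
    (hfree : ∀ l : List (Fin k × A), l ≠ [] → (l.IsChain fun q q' => q.1 ≠ q'.1) →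
      (∀ q ∈ l, q.2 ∈ B q.1) → (∀ q ∈ l, P.phi q.2 = 0) →
      P.phi (l.map Prod.snd).prod = 0 ∧ P.phi' (l.map Prod.snd).prod =
        ∑ j ∈ Finset.range l.length, (l.map fun q => P.phi' q.2).getD j 0 *
          P.phi ((l.eraseIdx j).map Prod.snd).prod) :
    P.InfinitesimallyFree B := by
  intro n hn i a hi ha hphi
  -- Extending the word to all of `ℕ` avoids bounds in the index arithmetic; the default beyond `n`
  -- is never used.
  set g : ℕ → Fin k × A := fun q =>
    if h : q < n then (i ⟨q, h⟩, a ⟨q, h⟩) else (i ⟨0, hn⟩, a ⟨0, hn⟩) with hg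
  have hg' : ∀ q (h : q < n), g q = (i ⟨q, h⟩, a ⟨q, h⟩) := fun q h => by rw [hg]; exact dif_pos h
  have hga : (List.ofFn a) = ((List.range n).map g).map Prod.snd := by
    refine List.ext_getElem (by simp) fun q h1 h2 => ?_
    simp only [List.length_ofFn] at h1
    simp [hg' q h1]
  have hmem : ∀ {p : Fin k × A → Prop}, (∀ j, p (i j, a j)) →
      ∀ {l : List ℕ}, (∀ q ∈ l, q < n) → ∀ x ∈ l.map g, p x := by
    intro p hp l hl x hx
    obtain ⟨q, hq, rfl⟩ := List.mem_map.1 hx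
    rw [hg' q (hl q hq)]
    exact hp _
  have hchain : ∀ s m, s + m ≤ n →
      ((List.range' s m).map g).IsChain fun q q' => q.1 ≠ q'.1 := by
    intro s m hsm
    rw [List.isChain_iff_getElem]
    intro q hq
    simp only [List.length_map, List.length_range'] at hq
    simp only [List.getElem_map, List.getElem_range', one_mul]
    rw [hg' _ (by omega), hg' _ (by omega)]
    exact hi _ _ (by simp; omega)
  have hrange : ∀ m, List.range m = List.range' 0 m := fun m => List.range_eq_range'
  have hlt : ∀ s m, s + m ≤ n → ∀ q ∈ List.range' s m, q < n := by
    intro s m hsm q hq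
    have := (List.mem_range'_1.1 hq).2
    omega
  have H := hfree ((List.range n).map g) (by simp; omega) (hrange n ▸ hchain 0 n (by omega))
    (hrange n ▸ hmem (p := fun x => x.2 ∈ B x.1) ha (hlt 0 n (by omega)))
    (hrange n ▸ hmem (p := fun x => P.phi x.2 = 0) hphi (hlt 0 n (by omega)))
  rw [hga]
  refine ⟨H.1, H.2.trans ?_⟩
  have hterm : ∀ j ∈ Finset.range ((List.range n).map g).length,
      (((List.range n).map g).map fun q => P.phi' q.2).getD j 0 *
        P.phi ((((List.range n).map g).eraseIdx j).map Prod.snd).prod =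
      P.phi' (g j).2 * nestedMoment P.phi ((List.range j).map g).reverse
        ((List.range' (j + 1) (n - 1 - j)).map g) := by
    intro j hj
    have hj : j < n := by simpa using hj
    congr 1
    · simp [List.getD_eq_getElem?_getD, hj]
    · have hsplit : ((List.range n).map g).eraseIdx j =
          (List.range j).map g ++ (List.range' (j + 1) (n - 1 - j)).map g := by
        rw [List.eraseIdx_eq_take_drop_succ, ← List.map_take, ← List.map_drop, List.take_range,
          min_eq_left hj.le, hrange n, List.drop_range']
        congr 3
        · omega
        · omega
      rw [hsplit, List.map_append, List.prod_append]
      have := prod_eq_nestedMoment P.phi_one (fun l h1 h2 h3 h4 => (hfree l h1 h2 h3 h4).1)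
        ((List.range j).map g).reverse ((List.range' (j + 1) (n - 1 - j)).map g)
        (List.isChain_reverse.2 ((hrange j ▸ hchain 0 j (by omega)).imp fun _ _ => Ne.symm))
        (hchain _ _ (by omega))
        (fun q hq => hmem (p := fun x => x.2 ∈ B x.1) ha (hlt 0 j (by omega)) q
          (hrange j ▸ List.mem_reverse.1 hq))
        (hmem (p := fun x => x.2 ∈ B x.1) ha (hlt _ _ (by omega)))
        (fun q hq => hmem (p := fun x => P.phi x.2 = 0) hphi (hlt 0 j (by omega)) q
          (hrange j ▸ List.mem_reverse.1 hq))
        (hmem (p := fun x => P.phi x.2 = 0) hphi (hlt _ _ (by omega)))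
      rwa [List.reverse_reverse] at this
  rw [Finset.sum_congr rfl hterm, List.length_map, List.length_range]
  have hrev : ∀ q (h : q < n / 2), g (n / 2 + 1 + n / 2 - 1 - q) =
      g (n - 1 - q) ∨ ¬ Odd n := by
    intro q h
    by_cases hodd : Odd n
    · obtain ⟨t, rfl⟩ := hodd
      left
      congr 1
      omega
    · exact Or.inr hodd
  have hrevval : ∀ j : Fin n, g (n - 1 - j) = (i j.rev, a j.rev) := by
    intro j
    rw [hg' _ (by omega)]
    have : (⟨n - 1 - j, by omega⟩ : Fin n) = j.rev := Fin.ext (by simp [Fin.val_rev]; omega)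
    rw [this]
  -- Equal lengths mean `n = 2 * j + 1`, hence `j = n / 2`. For even `n` the term at `n / 2`
  -- vanishes as well.
  rw [Finset.sum_eq_single (n / 2)]
  · rw [nestedMoment_range, hg' (n / 2) (Nat.div_lt_self hn one_lt_two), mul_comm]
    have hiff : (n - 1 - n / 2 = n / 2 ∧ ∀ q < n / 2,
        (g q).1 = (g (n / 2 + 1 + n / 2 - 1 - q)).1) ↔
        (Odd n ∧ ∀ j : Fin n, (j : ℕ) < n / 2 → i j = i j.rev) := by
      have hodd : n - 1 - n / 2 = n / 2 ↔ Odd n := by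
        rw [Nat.odd_iff]; omega
      rw [hodd]
      refine and_congr_right fun ho => ⟨fun h j hj => ?_, fun h q hq => ?_⟩
      · have := h j hj
        rw [(hrev j hj).resolve_right (not_not.2 ho), hg' j j.2, hrevval j] at this
        exact this
      · have hqn : q < n := by omega
        rw [(hrev q hq).resolve_right (not_not.2 ho), hg' q hqn, hrevval ⟨q, hqn⟩]
        exact h ⟨q, hqn⟩ hq
    simp only [hiff]
    split_ifs with h
    · congr 1
      rw [Finset.prod_filter]
      have hF : ∀ j : Fin n, (if (j : ℕ) < n / 2 then P.phi (a j * a j.rev) else 1) =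
          (fun q : ℕ => if q < n / 2 then P.phi ((g q).2 * (g (n - 1 - q)).2) else 1) j := by
        intro j
        simp only
        rw [hg' j j.2, hrevval j]
      rw [Finset.prod_congr rfl fun j _ => hF j, Fin.prod_univ_eq_prod_range
        (fun q : ℕ => if q < n / 2 then P.phi ((g q).2 * (g (n - 1 - q)).2) else 1) n, ← Finset.prod_filter]
      refine Finset.prod_congr ?_ fun q hq => ?_
      · ext q
        simp only [Finset.mem_range, Finset.mem_filter]
        omega
      · rw [(hrev q (Finset.mem_filter.1 hq).2).resolve_right (not_not.2 h.1)]
    · simp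
  · intro j hj hne
    have := Finset.mem_range.1 hj
    rw [nestedMoment_range, if_neg, mul_zero]
    rintro ⟨h, -⟩
    omega
  · intro h
    exact absurd (Finset.mem_range.2 (Nat.div_lt_self hn one_lt_two)) h

end Incps

/-! ### Moments and cumulants with values in the dual numbers -/

theorem TrivSqZeroExt.fst_finset_prod {ι : Type*} (s : Finset ι) (f : ι → DualNumber ℂ) :
    (∏ i ∈ s, f i).fst = ∏ i ∈ s, (f i).fst :=
  map_prod (TrivSqZeroExt.fstHom ℂ ℂ ℂ) f s

theorem TrivSqZeroExt.snd_finset_prod {ι : Type*} [DecidableEq ι] (s : Finset ι)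
    (f : ι → DualNumber ℂ) :
    (∏ i ∈ s, f i).snd = ∑ i ∈ s, (f i).snd * ∏ j ∈ s.erase i, (f j).fst := by
  induction s using Finset.induction_on with
  | empty => simp
  | insert a s ha ih =>
    rw [Finset.prod_insert ha, TrivSqZeroExt.snd_mul, ih, TrivSqZeroExt.fst_finset_prod,
      Finset.sum_insert ha, Finset.erase_insert ha, add_comm]
    congr 1
    rw [smul_eq_mul, Finset.mul_sum]
    refine Finset.sum_congr rfl fun i hi => ?_
    have hai : a ≠ i := fun h => ha (h ▸ hi)
    rw [Finset.erase_insert_of_ne hai, Finset.prod_insert fun h => ha (Finset.mem_of_mem_erase h)]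
    ring

theorem ofFn_restrictTuple {A : Type*} {n : ℕ} (a : Fin n → A) (V : Finset (Fin n)) :
    List.ofFn (restrictTuple a V) = V.sort.map a := by
  rw [List.ofFn_eq_map, ← Finset.listMap_orderEmbOfFin_finRange V rfl, List.map_map]
  rfl

theorem List.exists_eq_append_of_not_isChain {α : Type*} {r : α → α → Prop} {l : List α}
    (h : ¬ l.IsChain r) : ∃ l₁ x y l₂, l = l₁ ++ x :: y :: l₂ ∧ ¬ r x y := by
  induction l with
  | nil => exact absurd List.isChain_nil h
  | cons x l ih =>
    rcases l with _ | ⟨y, l⟩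
    · exact absurd (List.isChain_singleton x) h
    · rw [List.isChain_cons_cons, not_and_or] at h
      rcases h with h | h
      · exact ⟨[], x, y, l, rfl, h⟩
      · obtain ⟨l₁, u, v, l₂, he, huv⟩ := ih h
        exact ⟨x :: l₁, u, v, l₂, by rw [he, List.cons_append], huv⟩

/-- Linear maps that agree on the words in some elements agree on the algebra they generate. -/
theorem LinearMap.eqOn_adjoin_of_words {A M Y : Type*} [Ring A] [Algebra ℂ A] [AddCommGroup M]
    [Module ℂ M] {f g : A →ₗ[ℂ] M} {y : Y → A}
    (h : ∀ l : List Y, f (l.map y).prod = g (l.map y).prod) {a : A}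
    (ha : a ∈ Algebra.adjoin ℂ (Set.range y)) : f a = g a := by
  rw [← Subalgebra.mem_toSubmodule, Algebra.adjoin_eq_span] at ha
  refine LinearMap.eqOn_span (fun x hx => ?_) ha
  obtain ⟨l, hl, rfl⟩ := Submonoid.exists_list_of_mem_closure hx
  obtain ⟨l, rfl⟩ : ∃ l' : List Y, l'.map y = l := by
    clear hx ha
    induction l with
    | nil => exact ⟨[], rfl⟩
    | cons x l ih =>
      obtain ⟨l', rfl⟩ := ih fun z hz => hl z (List.mem_cons_of_mem _ hz)
      obtain ⟨z, rfl⟩ := hl x List.mem_cons_self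
      exact ⟨z :: l', rfl⟩
  exact h l

namespace Incps

variable {A A' : Type*} [Ring A] [Algebra ℂ A] [Ring A'] [Algebra ℂ A']

/-- The functional `φ + ε φ'` with values in the dual numbers. -/
noncomputable def total (P : Incps A) : A →ₗ[ℂ] DualNumber ℂ :=
  TrivSqZeroExt.inlAlgHom ℂ ℂ ℂ ∘ₗ P.phi + TrivSqZeroExt.inrHom ℂ ℂ ∘ₗ P.phi'

@[simp] theorem fst_total (P : Incps A) (a : A) : (P.total a).fst = P.phi a := by
  simp [total]

@[simp] theorem snd_total (P : Incps A) (a : A) : (P.total a).snd = P.phi' a := by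
  simp [total]

theorem total_one (P : Incps A) : P.total 1 = 1 := by
  ext <;> simp [P.phi_one, P.phi'_one]

/-- The pair of functionals given by a unital functional with values in the dual numbers. -/
noncomputable def ofTotal (ψ : A →ₗ[ℂ] DualNumber ℂ) (hψ : ψ 1 = 1) : Incps A where
  phi := TrivSqZeroExt.fstHom ℂ ℂ ℂ ∘ₗ ψ
  phi' := TrivSqZeroExt.sndHom ℂ ℂ ∘ₗ ψ
  phi_one := by simp [hψ]
  phi'_one := by simp [hψ]

theorem phi_ofTotal (ψ : A →ₗ[ℂ] DualNumber ℂ) (hψ : ψ 1 = 1) (a : A) :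
    (ofTotal ψ hψ).phi a = (ψ a).fst := rfl

theorem phi'_ofTotal (ψ : A →ₗ[ℂ] DualNumber ℂ) (hψ : ψ 1 = 1) (a : A) :
    (ofTotal ψ hψ).phi' a = (ψ a).snd := rfl

theorem total_ofTotal (ψ : A →ₗ[ℂ] DualNumber ℂ) (hψ : ψ 1 = 1) (a : A) :
    (ofTotal ψ hψ).total a = ψ a := by
  ext <;> simp [phi_ofTotal, phi'_ofTotal]

/-- The non-crossing cumulants `κ_n + ε κ_n'` of `φ + ε φ'`. -/
noncomputable def cumulant (P : Incps A) {n : ℕ} (a : Fin n → A) : DualNumber ℂ :=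
  ∑ π : NC n, algebraMap ℂ (DualNumber ℂ) (NC.moebius π (NC.one n)) *
    ∏ V ∈ π.blocks, P.total (V.sort.map a).prod

theorem fst_cumulant (P : Incps A) {n : ℕ} (a : Fin n → A) : (P.cumulant a).fst = P.kappa a := by
  simp only [cumulant, kappa, momentFunctional, ofFn_restrictTuple, TrivSqZeroExt.fst_sum,
    TrivSqZeroExt.fst_mul, TrivSqZeroExt.fst_finset_prod, fst_total,
    TrivSqZeroExt.algebraMap_eq_inl, TrivSqZeroExt.fst_inl]

theorem snd_cumulant (P : Incps A) {n : ℕ} (a : Fin n → A) : (P.cumulant a).snd = P.kappa' a := by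
  simp only [cumulant, kappa', momentFunctional, ofFn_restrictTuple, TrivSqZeroExt.snd_sum,
    TrivSqZeroExt.snd_mul, TrivSqZeroExt.snd_finset_prod, fst_total, snd_total,
    TrivSqZeroExt.algebraMap_eq_inl, TrivSqZeroExt.fst_inl, TrivSqZeroExt.snd_inl, smul_zero,
    add_zero, smul_eq_mul, Finset.mul_sum, mul_assoc]

theorem cumulant_eq_zero_iff (P : Incps A) {n : ℕ} (a : Fin n → A) :
    P.cumulant a = 0 ↔ P.kappa a = 0 ∧ P.kappa' a = 0 := by
  rw [← fst_cumulant, ← snd_cumulant, TrivSqZeroExt.ext_iff]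
  rfl

theorem cumulant_congr (P : Incps A) {n m : ℕ} (h : n = m) {a : Fin n → A} {b : Fin m → A}
    (hab : ∀ j, a j = b (Fin.cast h j)) : P.cumulant a = P.cumulant b := by
  subst h
  rw [show a = b from funext hab]

theorem cumulant_eq_of_moments {P : Incps A} {Q : Incps A'} {n : ℕ} {a : Fin n → A}
    {b : Fin n → A'}
    (h : ∀ l : List (Fin n), P.total (l.map a).prod = Q.total (l.map b).prod) :
    P.cumulant a = Q.cumulant b := by
  simp only [cumulant, h]

/-- The partition `one n` has Möbius coefficient `1`, so the full moment splits off; the other terms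
involve only shorter moments, which allows recursion on length. -/
theorem cumulant_comp {Y : Type*} (P : Incps A) {n : ℕ} (hn : 1 ≤ n) (t : Fin n → Y) (y : Y → A) :
    P.cumulant (fun j => y (t j)) = P.total ((List.ofFn t).map y).prod +
      ∑ π ∈ Finset.univ.erase (NC.one n),
        algebraMap ℂ (DualNumber ℂ) (NC.moebius π (NC.one n)) *
          ∏ V ∈ π.blocks, P.total ((V.sort.map t).map y).prod := by
  rw [cumulant, ← Finset.add_sum_erase _ _ (Finset.mem_univ (NC.one n)), NC.blocks_one hn,
    Finset.prod_singleton, Fin.sort_univ, ← List.ofFn_eq_map, NC.moebius,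
    IncidenceAlgebra.mu_self, map_one, one_mul, List.map_ofFn]
  simp only [List.map_map, Function.comp_def]

/-- The moments are determined by the cumulants. -/
theorem moments_eq_of_cumulant {Y : Type*} {P : Incps A} {Q : Incps A'} {y : Y → A} {y' : Y → A'}
    (h : ∀ n, 1 ≤ n → ∀ t : Fin n → Y,
      P.cumulant (fun j => y (t j)) = Q.cumulant (fun j => y' (t j)))
    (l : List Y) : P.total (l.map y).prod = Q.total (l.map y').prod := by
  induction hn : l.length using Nat.strong_induction_on generalizing l with
  | _ n ih =>
    rcases Nat.eq_zero_or_pos n with h0 | hpos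
    · obtain rfl : l = [] := List.length_eq_zero_iff.1 (hn.trans h0)
      simp [total_one]
    · set t : Fin n → Y := fun j => l.get (Fin.cast hn.symm j) with ht
      have hl : List.ofFn t = l := by
        subst hn
        exact List.ofFn_get l
      have H := h n hpos t
      rw [P.cumulant_comp hpos t y, Q.cumulant_comp hpos t y', hl] at H
      have hrest : ∀ π ∈ Finset.univ.erase (NC.one n),
          algebraMap ℂ (DualNumber ℂ) (NC.moebius π (NC.one n)) *
            ∏ V ∈ π.blocks, P.total ((V.sort.map t).map y).prod =
          algebraMap ℂ (DualNumber ℂ) (NC.moebius π (NC.one n)) *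
            ∏ V ∈ π.blocks, Q.total ((V.sort.map t).map y').prod := by
        intro π hπ
        congr 1
        refine Finset.prod_congr rfl fun V hV => ih V.card ?_ _ ?_
        · exact NC.card_lt_of_mem_blocks (Finset.ne_of_mem_erase hπ) hV
        · rw [List.length_map, Finset.length_sort]
      rw [Finset.sum_congr rfl hrest] at H
      exact add_right_cancel H

/-- The pullback of a pair of functionals along a homomorphism. -/
def comap (P : Incps A) (g : A' →ₐ[ℂ] A) : Incps A' where
  phi := P.phi ∘ₗ g.toLinearMap
  phi' := P.phi' ∘ₗ g.toLinearMap
  phi_one := by simp [P.phi_one]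
  phi'_one := by simp [P.phi'_one]

theorem phi_comap (P : Incps A) (g : A' →ₐ[ℂ] A) (a : A') : (P.comap g).phi a = P.phi (g a) := rfl

theorem phi'_comap (P : Incps A) (g : A' →ₐ[ℂ] A) (a : A') :
    (P.comap g).phi' a = P.phi' (g a) := rfl

theorem total_comap (P : Incps A) (g : A' →ₐ[ℂ] A) (a : A') :
    (P.comap g).total a = P.total (g a) := rfl

theorem cumulant_comap (P : Incps A) (g : A' →ₐ[ℂ] A) {n : ℕ} (a : Fin n → A') :
    (P.comap g).cumulant a = P.cumulant fun j => g (a j) :=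
  cumulant_eq_of_moments fun l => by
    rw [total_comap, map_list_prod, List.map_map]
    rfl

theorem InfinitesimallyFree.comap {P : Incps A} {k : ℕ} {B : Fin k → Subalgebra ℂ A}
    (hP : P.InfinitesimallyFree B) {g : A' →ₐ[ℂ] A} {B' : Fin k → Subalgebra ℂ A'}
    (hB : ∀ i, ∀ b ∈ B' i, g b ∈ B i) : (P.comap g).InfinitesimallyFree B' := by
  intro n hn i a hi ha hphi
  have := hP n hn i (fun j => g (a j)) hi (fun j => hB _ _ (ha j)) hphi
  simpa only [phi_comap, phi'_comap, map_list_prod, List.map_ofFn, map_mul, Function.comp_def]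
    using this

theorem InfinitesimallyFree.of_comap {P : Incps A} {k : ℕ} {B : Fin k → Subalgebra ℂ A}
    {g : A' →ₐ[ℂ] A} {B' : Fin k → Subalgebra ℂ A'}
    (hP : (P.comap g).InfinitesimallyFree B') (hB : ∀ i, ∀ b ∈ B i, ∃ b' ∈ B' i, g b' = b) :
    P.InfinitesimallyFree B := by
  intro n hn i a hi ha hphi
  choose a' ha' hga using fun j => hB (i j) (a j) (ha j)
  obtain rfl : (fun j => g (a' j)) = a := funext hga
  have := hP n hn i a' hi ha' hphi
  simpa only [phi_comap, phi'_comap, map_list_prod, List.map_ofFn, map_mul, Function.comp_def]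
    using this

/-! ### Infinitesimal freeness determines the mixed moments -/

theorem InfinitesimallyFree.total_eq_of_centred {P Q : Incps A} {k : ℕ}
    {B : Fin k → Subalgebra ℂ A} (hP : P.InfinitesimallyFree B) (hQ : Q.InfinitesimallyFree B)
    (h : ∀ i, ∀ b ∈ B i, P.total b = Q.total b) (l : List (Fin k × A))
    (hl : l.IsChain fun q q' => q.1 ≠ q'.1) (hmem : ∀ q ∈ l, q.2 ∈ B q.1)
    (hcen : ∀ q ∈ l, P.phi q.2 = 0) :
    P.total (l.map Prod.snd).prod = Q.total (l.map Prod.snd).prod := by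
  have hphi : ∀ i, ∀ b ∈ B i, P.phi b = Q.phi b := fun i b hb => by
    rw [← fst_total, ← fst_total, h i b hb]
  have hphi' : ∀ i, ∀ b ∈ B i, P.phi' b = Q.phi' b := fun i b hb => by
    rw [← snd_total, ← snd_total, h i b hb]
  rcases Nat.eq_zero_or_pos l.length with h0 | hpos
  · obtain rfl := List.length_eq_zero_iff.1 h0
    simp [total_one]
  · set i : Fin l.length → Fin k := fun j => l[j].1 with hi
    set a : Fin l.length → A := fun j => l[j].2 with ha
    have hla : l.map Prod.snd = List.ofFn a := by
      refine List.ext_getElem (by simp) fun q h1 h2 => ?_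
      simp [ha]
    have hne : ∀ p q : Fin l.length, (q : ℕ) = p + 1 → i p ≠ i q := by
      rintro ⟨p, hp⟩ ⟨q, hq⟩ hpq
      obtain rfl : q = p + 1 := hpq
      exact List.isChain_iff_getElem.1 hl p hq
    have haB : ∀ j, a j ∈ B (i j) := fun j => hmem _ (List.getElem_mem _)
    have hac : ∀ j, P.phi (a j) = 0 := fun j => hcen _ (List.getElem_mem _)
    obtain ⟨p1, p2⟩ := hP _ hpos i a hne haB hac
    obtain ⟨q1, q2⟩ := hQ _ hpos i a hne haB fun j => hphi _ _ (haB j) ▸ hac j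
    rw [hla]
    ext
    · rw [fst_total, fst_total, p1, q1]
    · rw [snd_total, snd_total, p2, q2]
      refine ite_congr rfl (fun hsym => ?_) fun _ => rfl
      rw [hphi' _ _ (haB _)]
      congr 1
      -- Mirrored colours put `a j` and `a j.rev` in the same subalgebra, where the two functionals
      -- agree.
      refine Finset.prod_congr rfl fun j hj => hphi (i j) _ (Subalgebra.mul_mem _ (haB j) ?_)
      rw [hsym.2 j (Finset.mem_filter.1 hj).2]
      exact haB _

/-- Infinitesimal freeness determines the moments from those of the single subalgebras. -/
theorem InfinitesimallyFree.total_eq {P Q : Incps A} {k : ℕ}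
    {B : Fin k → Subalgebra ℂ A} (hP : P.InfinitesimallyFree B) (hQ : Q.InfinitesimallyFree B)
    (h : ∀ i, ∀ b ∈ B i, P.total b = Q.total b) (l : List (Fin k × A))
    (hmem : ∀ q ∈ l, q.2 ∈ B q.1) :
    P.total (l.map Prod.snd).prod = Q.total (l.map Prod.snd).prod := by
  induction hn : l.length using Nat.strong_induction_on generalizing l with
  | _ n ih =>
    by_cases hl : l.IsChain fun q q' => q.1 ≠ q'.1
    -- The letters are centred one at a time, `l₁` being the part already done. The scalar
    -- correction drops a letter and may break alternation, so the outer induction on length covers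
    -- arbitrary words.
    · suffices H : ∀ l₂ l₁ : List (Fin k × A), (l₁ ++ l₂).length = n →
          ((l₁ ++ l₂).IsChain fun q q' => q.1 ≠ q'.1) → (∀ q ∈ l₁ ++ l₂, q.2 ∈ B q.1) →
          (∀ q ∈ l₁, P.phi q.2 = 0) → P.total ((l₁ ++ l₂).map Prod.snd).prod =
            Q.total ((l₁ ++ l₂).map Prod.snd).prod from
        H l [] hn hl hmem (by simp)
      intro l₂
      induction l₂ with
      | nil =>
        intro l₁ _ hl hmem hcen
        rw [List.append_nil] at *
        exact hP.total_eq_of_centred hQ h l₁ hl hmem hcen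
      | cons x l₂ ih₂ =>
        intro l₁ hn hl hmem hcen
        set z : Fin k × A := (x.1, x.2 - P.phi x.2 • 1) with hz
        have hsplit : ((l₁ ++ x :: l₂).map Prod.snd).prod =
            (((l₁ ++ [z]) ++ l₂).map Prod.snd).prod +
              P.phi x.2 • ((l₁ ++ l₂).map Prod.snd).prod := by
          simp [hz, sub_mul, mul_sub]
        have hmem' : ∀ q ∈ l₁ ++ l₂, q.2 ∈ B q.1 := fun q hq => hmem q (by
          rcases List.mem_append.1 hq with hq | hq <;> simp [hq])
        rw [hsplit, map_add, map_add, map_smul, map_smul,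
          ih (l₁ ++ l₂).length (by simp at hn ⊢; omega) (l₁ ++ l₂) hmem' rfl,
          ih₂ (l₁ ++ [z]) (by simpa using hn)]
        · have hmap : (l₁ ++ [z] ++ l₂).map Prod.fst = (l₁ ++ x :: l₂).map Prod.fst := by
            simp [hz]
          rw [← List.isChain_map (R := (· ≠ ·)) Prod.fst, ← hmap, List.isChain_map] at hl
          exact hl
        · intro q hq
          rw [List.append_assoc, List.mem_append, List.singleton_append, List.mem_cons] at hq
          rcases hq with hq | rfl | hq
          · exact hmem q (by simp [hq])
          · exact Subalgebra.sub_mem _ (hmem x (by simp))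
              (Subalgebra.smul_mem _ (Subalgebra.one_mem _) _)
          · exact hmem q (by simp [hq])
        · intro q hq
          rcases List.mem_append.1 hq with hq | hq
          · exact hcen q hq
          · rw [List.mem_singleton.1 hq]
            simp [hz, P.phi_one]
    -- Two neighbours of equal colour are multiplied into one letter, which shortens the word.
    · obtain ⟨l₁, x, y, l₂, rfl, hxy⟩ := List.exists_eq_append_of_not_isChain hl
      have hxy : x.1 = y.1 := not_not.1 hxy
      have := ih (l₁ ++ (x.1, x.2 * y.2) :: l₂).length (by rw [← hn]; simp)
        (l₁ ++ (x.1, x.2 * y.2) :: l₂) ?_ rfl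
      · simpa [mul_assoc] using this
      · intro q hq
        rcases List.mem_append.1 hq with hq | hq
        · exact hmem q (by simp [hq])
        · rcases List.mem_cons.1 hq with rfl | hq
          · exact Subalgebra.mul_mem _ (hmem x (by simp)) (hxy ▸ hmem y (by simp))
          · exact hmem q (by simp [hq])

end Incps

/-! ### Comparison with the model and the two implications -/

namespace Fock

variable {Y : Type*}

/-- The pair of functionals on the free algebra whose non-crossing cumulants are given by `c`. -/
noncomputable def incps (c : List Y → DualNumber ℂ) : Incps (FreeAlgebra ℂ Y) :=
  Incps.ofTotal (state c) (state_one c)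

theorem total_incps (c : List Y → DualNumber ℂ) (p : FreeAlgebra ℂ Y) :
    (incps c).total p = state c p := Incps.total_ofTotal _ _ _

theorem cumulant_incps (c : List Y → DualNumber ℂ) {n : ℕ} (hn : 1 ≤ n) (t : Fin n → Y) :
    (incps c).cumulant (fun j => FreeAlgebra.ι ℂ (t j)) = c (List.ofFn t) := by
  simp only [Incps.cumulant, total_incps]
  exact sum_moebius_state hn c t

/-- The two components of `state_prod_of_centred` are the two hypotheses of
`Incps.infinitesimallyFree_of_prod_eq`. -/
theorem infinitesimallyFree_incps {k : ℕ} {c : List Y → DualNumber ℂ} {col : Y → Fin k}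
    (hc : ∀ x s, (∃ z ∈ s, col z ≠ col x) → c (x :: s) = 0) :
    (incps c).InfinitesimallyFree fun i =>
      Algebra.adjoin ℂ (FreeAlgebra.ι ℂ '' {y | col y = i}) := by
  refine Incps.infinitesimallyFree_of_prod_eq _ fun l hne hl hmem hcen => ?_
  have h := state_prod_of_centred hc l hne hl hmem hcen
  have hphi : ∀ p, (state c p).fst = (incps c).phi p := fun _ => rfl
  have hphi' : ∀ p, (state c p).snd = (incps c).phi' p := fun _ => rfl
  have hfst : ∀ j, ((l.map fun q => state c q.2).getD j 0).fst = 0 := by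
    intro j
    by_cases hj : j < l.length
    · rw [List.getD_eq_getElem _ _ (by simpa using hj), List.getElem_map]
      exact hcen _ (List.getElem_mem hj)
    · rw [List.getD_eq_default _ _ (by simpa using hj), TrivSqZeroExt.fst_zero]
  have hsnd : ∀ j, ((l.map fun q => state c q.2).getD j 0).snd =
      (l.map fun q => (incps c).phi' q.2).getD j 0 := by
    intro j
    by_cases hj : j < l.length
    · rw [List.getD_eq_getElem _ _ (by simpa using hj), List.getElem_map,
        List.getD_eq_getElem _ _ (by simpa using hj), List.getElem_map, hphi']
    · rw [List.getD_eq_default _ _ (by simpa using hj), TrivSqZeroExt.snd_zero,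
        List.getD_eq_default _ _ (by simpa using hj)]
  constructor
  · rw [← hphi, h, TrivSqZeroExt.fst_sum]
    simp only [TrivSqZeroExt.fst_mul, hfst, zero_mul, Finset.sum_const_zero]
  · rw [← hphi', h, TrivSqZeroExt.snd_sum]
    simp only [DualNumber.snd_mul, hfst, hsnd, hphi, zero_mul, zero_add]

end Fock

namespace Incps

variable {A : Type*} [Ring A] [Algebra ℂ A] {k : ℕ}

/-- The evaluation of the free algebra on the disjoint union of the sets `X i`. -/
noncomputable def evalSigma (X : Fin k → Set A) : FreeAlgebra ℂ (Σ i, X i) →ₐ[ℂ] A :=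
  FreeAlgebra.lift ℂ fun y => (y.2 : A)

theorem evalSigma_ι (X : Fin k → Set A) (y : Σ i, X i) :
    evalSigma X (FreeAlgebra.ι ℂ y) = y.2 := by
  simp [evalSigma]

theorem map_evalSigma_adjoin (X : Fin k → Set A) (i : Fin k) :
    (Algebra.adjoin ℂ (FreeAlgebra.ι ℂ '' {y : Σ i, X i | y.1 = i})).map (evalSigma X) =
      Algebra.adjoin ℂ (X i) := by
  rw [AlgHom.map_adjoin]
  congr 1
  ext x
  simp only [Set.mem_image, Set.mem_ofPred_eq, exists_exists_and_eq_and, evalSigma_ι]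
  constructor
  · rintro ⟨⟨j, x⟩, rfl, rfl⟩
    exact x.2
  · exact fun hx => ⟨⟨i, x, hx⟩, rfl, rfl⟩

/-- The cumulant of a word of elements of the sets `X i`. -/
noncomputable def wordCumulant (P : Incps A) (X : Fin k → Set A) (w : List (Σ i, X i)) :
    DualNumber ℂ :=
  P.cumulant fun j : Fin w.length => (w[j].2 : A)

theorem wordCumulant_ofFn (P : Incps A) (X : Fin k → Set A) {n : ℕ} (t : Fin n → Σ i, X i) :
    P.wordCumulant X (List.ofFn t) = P.cumulant fun j => ((t j).2 : A) :=
  cumulant_congr P List.length_ofFn fun j =>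
    congrArg (fun y : Σ i, X i => (y.2 : A)) (List.getElem_ofFn j.2)

/-- The moments of words in the generators determine the moments of the free algebra. -/
theorem ext_freeAlgebra {Y : Type*} {P Q : Incps (FreeAlgebra ℂ Y)}
    (h : ∀ l : List Y, P.total (l.map (FreeAlgebra.ι ℂ)).prod =
      Q.total (l.map (FreeAlgebra.ι ℂ)).prod) : P = Q := by
  have H : ∀ p, P.total p = Q.total p := fun p =>
    LinearMap.eqOn_adjoin_of_words h (by rw [FreeAlgebra.adjoin_range_ι]; trivial)
  have h1 : P.phi = Q.phi := LinearMap.ext fun p => by rw [← fst_total, ← fst_total, H]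
  have h2 : P.phi' = Q.phi' := LinearMap.ext fun p => by rw [← snd_total, ← snd_total, H]
  cases P
  cases Q
  simp only at h1 h2
  subst h1 h2
  rfl

/-- The pullback to the free algebra on the disjoint union, where every letter has a definite
colour, has the same cumulants on generators as the model with weights `wordCumulant`, hence equals
it. Freeness descends because each coloured subalgebra maps onto `Algebra.adjoin ℂ (X i)`. -/
theorem MixedCumulantsVanish.infinitesimallyFree {P : Incps A} {X : Fin k → Set A}
    (h : P.MixedCumulantsVanish X) :
    P.InfinitesimallyFree fun i => Algebra.adjoin ℂ (X i) := by
  have hP : P.comap (evalSigma X) = Fock.incps (P.wordCumulant X) := by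
    refine ext_freeAlgebra (moments_eq_of_cumulant fun n hn t => ?_)
    rw [cumulant_comap, Fock.cumulant_incps _ hn, wordCumulant_ofFn]
    simp only [evalSigma_ι]
  have hc : ∀ (x : Σ i, X i) (s : List (Σ i, X i)), (∃ z ∈ s, z.1 ≠ x.1) →
      P.wordCumulant X (x :: s) = 0 := by
    rintro x s ⟨z, hz, hzx⟩
    obtain ⟨j, hj, rfl⟩ := List.getElem_of_mem hz
    refine (cumulant_eq_zero_iff _ _).2 (h _ ?_ (fun j => (x :: s)[j].1) ?_ _ ?_)
    · rw [List.length_cons]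
      omega
    · intro hall
      exact hzx (hall ⟨j + 1, by simpa using hj⟩ ⟨0, by simp⟩)
    · exact fun j => (x :: s)[j].2.2
  refine InfinitesimallyFree.of_comap (g := evalSigma X) (hP ▸ Fock.infinitesimallyFree_incps hc)
    fun i b hb => ?_
  rw [← map_evalSigma_adjoin, Subalgebra.mem_map] at hb
  exact hb

theorem InfinitesimallyFree.mixedCumulantsVanish {P : Incps A} {B : Fin k → Subalgebra ℂ A}
    (h : P.InfinitesimallyFree B) : P.MixedCumulantsVanish fun i => (B i : Set A) := by
  classical
  intro n hn i hi a ha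
  rw [← cumulant_eq_zero_iff]
  let X : Fin k → Set A := fun i => B i
  -- The weights keep the true cumulants within each subalgebra and set the mixed ones to zero.
  let c : List (Σ i, X i) → DualNumber ℂ := fun w =>
    if ∀ z ∈ w, ∀ z' ∈ w, z.1 = z'.1 then P.wordCumulant X w else 0
  let F : Fin k → Subalgebra ℂ (FreeAlgebra ℂ (Σ i, X i)) := fun i =>
    Algebra.adjoin ℂ (FreeAlgebra.ι ℂ '' {y | y.1 = i})
  have hc : ∀ (x : Σ i, X i) (s : List (Σ i, X i)), (∃ z ∈ s, z.1 ≠ x.1) → c (x :: s) = 0 := by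
    rintro x s ⟨z, hz, hzx⟩
    exact if_neg fun hall => hzx (hall z (List.mem_cons_of_mem _ hz) x List.mem_cons_self)
  have hQ : (Fock.incps c).InfinitesimallyFree F := Fock.infinitesimallyFree_incps hc
  have hP : (P.comap (evalSigma X)).InfinitesimallyFree F := by
    refine h.comap fun j b hb => ?_
    have : evalSigma X b ∈ (F j).map (evalSigma X) := Subalgebra.mem_map.2 ⟨b, hb, rfl⟩
    rwa [map_evalSigma_adjoin X j, Algebra.adjoin_eq] at this
  -- On words of a single colour the cumulants of both functionals agree, hence so do the moments.
  have hF : ∀ j, ∀ b ∈ F j, (P.comap (evalSigma X)).total b = (Fock.incps c).total b := by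
    intro j b hb
    refine LinearMap.eqOn_adjoin_of_words
      (y := fun y : {y : Σ i, X i // y.1 = j} => FreeAlgebra.ι ℂ y.1) ?_ ?_
    · refine moments_eq_of_cumulant fun m hm t => ?_
      rw [cumulant_comap, Fock.cumulant_incps c hm fun q => (t q).1]
      simp only [evalSigma_ι]
      rw [← wordCumulant_ofFn P X fun q => (t q).1]
      refine (if_pos fun z hz z' hz' => ?_).symm
      obtain ⟨q, rfl⟩ := List.mem_ofFn.1 hz
      obtain ⟨q', rfl⟩ := List.mem_ofFn.1 hz'
      exact (t q).2.trans (t q').2.symm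
    · have hset : Set.range (fun y : {y : Σ i, X i // y.1 = j} => FreeAlgebra.ι ℂ y.1) =
          FreeAlgebra.ι ℂ '' {y | y.1 = j} := by
        rw [Set.range_comp' (FreeAlgebra.ι ℂ) Subtype.val]
        exact congrArg _ Subtype.range_val
      rw [hset]
      exact hb
  let t : Fin n → Σ i, X i := fun j => ⟨i j, a j, ha j⟩
  have hcum : (P.comap (evalSigma X)).cumulant (fun j => FreeAlgebra.ι ℂ (t j)) =
      (Fock.incps c).cumulant fun j => FreeAlgebra.ι ℂ (t j) := by
    refine cumulant_eq_of_moments fun l => ?_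
    have := hP.total_eq hQ hF (l.map fun j => ((t j).1, FreeAlgebra.ι ℂ (t j))) ?_
    · simpa only [List.map_map, Function.comp_def] using this
    · intro q hq
      obtain ⟨j, -, rfl⟩ := List.mem_map.1 hq
      exact Algebra.subset_adjoin ⟨t j, rfl, rfl⟩
  rw [cumulant_comap, Fock.cumulant_incps c (by omega)] at hcum
  simp only [evalSigma_ι] at hcum
  refine hcum.trans (if_neg fun hall => hi fun p q => ?_)
  exact hall (t p) (List.mem_ofFn.2 ⟨p, rfl⟩) (t q) (List.mem_ofFn.2 ⟨q, rfl⟩)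

end Incps

theorem theorem1p2 {A : Type*} [Ring A] [Algebra ℂ A] (P : Incps A) (k : ℕ) :
    (∀ B : Fin k → Subalgebra ℂ A,
      P.InfinitesimallyFree B ↔ P.MixedCumulantsVanish (fun i => (B i : Set A))) ∧
    (∀ X : Fin k → Set A,
      P.InfinitesimallyFree (fun i => Algebra.adjoin ℂ (X i)) ↔ P.MixedCumulantsVanish X) := by
  refine ⟨fun B => ⟨fun h => h.mixedCumulantsVanish, fun h => ?_⟩, fun X => ⟨fun h => ?_,
    fun h => h.infinitesimallyFree⟩⟩
  -- A subalgebra generates itself, so this is the criterion for generating sets.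
  · simpa only [Algebra.adjoin_eq] using h.infinitesimallyFree
  · intro n hn i hi a ha
    exact h.mixedCumulantsVanish n hn i hi a fun j => Algebra.subset_adjoin (ha j)
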